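/- **Conventions.** Let $\pi\colon\mathbb R\to\mathbb R/\mathbb Z$ be the projection and let $\lVert x\rVert$ be the distance from $x\in\mathbb R$ to the nearest integer. By convention $\deg(0)=-1$. For $R(x)=\sum_{i=0}^d a_ix^i\in\mathbb R[x]$, the *length* of $R$ is $L(R)=\sum_{i=0}^d|a_i|$, and the *reduced length* of $R$ is $\ell(R)=\inf_Q L(RQ)$, where $Q$ runs through the polynomials in $\mathbb R[x]$ with leading coefficient $1$ or constant coefficient $1$. A *Pisot number* is a real algebraic integer $\beta>1$ all of whose Galois conjugates in $\mathbb C$ other than $\beta$ have modulus $<1$. A *Salem number* is a real algebraic integer $\beta>1$ all of whose Galois conjugates in $\mathbb C$ other than $\beta$ have modulus $\le 1$ and which is not a Pisot number. A *limit value* of a sequence is the limit of a convergent subsequence. **Corollary 1.7.** Let $\alpha$ be a real algebraic number with $|\alpha|>1$, and let $P(x)\in\mathbb Z[x]$ be its minimal polynomial (irreducible in $\mathbb Z[x]$ with $P(\alpha)=0$; it is unique up to sign). Let $F(x),G(x)\in\mathbb R[x]$ with $f=\deg(F)\ge 0$ and $g=\deg(G)\ge -1$. Assume that at least one of the following conditions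 holds: 1. $|\alpha|$ is neither a Pisot number nor a Salem number; 2. $F(x)\notin\mathbb Q(\alpha)[x]$; 3. $G(x)-G(0)\notin\mathbb Q[x]$; 4. $|\alpha|$ is a Salem number and $f>0$. Let $x_k=F(k)\alpha^k+G(k)$ for $k\ge 1$. Then the following hold. * For every nonzero polynomial $Q(x)\in\mathbb Z[x]$, $$\limsup_{k\to\infty}\lVert x_k\rVert\ \ge\ \frac{1}{L\bigl((x-1)^{g+1}P(x)^{f+1}Q(x)\bigr)}.$$ * For every integer $M\ge 1$ there exists an integer $l\ge 0$ such that the set of limit values of $(\pi(x_{kM+l}))_{k\ge 1}$ is not contained in any interval of $\mathbb R/\mathbb Z$ of length $<1/\ell\bigl((x-1)^{\max(g,0)}P(x)^{f+1}\bigr)$. * Moreover, if condition 3 holds, then the set of limit values of $(\pi(x_k))_{k\ge 1}$ is not contained in any interval of $\mathbb R/\mathbb Z$ of length $<1/\inf_Q L(P^{f+1}Q)$, where $Q$ runs through the polynomials in $\mathbb Z[x]$ satisfying $Q(1)\ne 0$. -/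

import Mathlib

open Polynomial Filter

/-- The degree of a real polynomial, with the convention that the zero polynomial has degree `-1`. -/
noncomputable def polyDeg (F : ℝ[X]) : ℤ :=
  if F = 0 then -1 else (F.natDegree : ℤ)

/-- The length of a real polynomial: the sum of the absolute values of its coefficients. -/
noncomputable def polyLength (R : ℝ[X]) : ℝ :=
  ∑ i ∈ R.support, |R.coeff i|

/-- The length of an integer polynomial. -/
noncomputable def intPolyLength (R : ℤ[X]) : ℝ :=
  polyLength (R.map (Int.castRingHom ℝ))

/-- The reduced length of a real polynomial `R`: the infimum of the lengths of the products `R * Q`,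
where `Q` runs through the real polynomials with leading coefficient `1` or constant
coefficient `1`. -/
noncomputable def reducedLength (R : ℝ[X]) : ℝ :=
  sInf {t : ℝ | ∃ Q : ℝ[X], (Q.leadingCoeff = 1 ∨ Q.coeff 0 = 1) ∧ t = polyLength (R * Q)}

/-- The reduced length of an integer polynomial (the multipliers are still real polynomials). -/
noncomputable def intReducedLength (R : ℤ[X]) : ℝ :=
  reducedLength (R.map (Int.castRingHom ℝ))

/-- `P` is the minimal polynomial in `ℤ[X]` of the real number `α`, unique up to sign. Being
irreducible in `ℤ[X]` with the real root `α`, it is primitive of positive degree. -/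
def IsIntMinpoly (P : ℤ[X]) (α : ℝ) : Prop :=
  Irreducible P ∧ aeval α P = 0

/-- Pisot numbers: real algebraic integers `> 1` all of whose other Galois conjugates in `ℂ` have
modulus `< 1`. -/
def IsPisot (β : ℝ) : Prop :=
  1 < β ∧ IsIntegral ℤ β ∧ ∀ z : ℂ, IsConjRoot ℚ (β : ℂ) z → z ≠ (β : ℂ) → ‖z‖ < 1

/-- Salem numbers: real algebraic integers `> 1` all of whose other Galois conjugates in `ℂ` have
modulus `≤ 1`, and which are not Pisot numbers. -/
def IsSalem (β : ℝ) : Prop :=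
  1 < β ∧ IsIntegral ℤ β ∧ (∀ z : ℂ, IsConjRoot ℚ (β : ℂ) z → z ≠ (β : ℂ) → ‖z‖ ≤ 1) ∧ ¬ IsPisot β

/-- The distance from a real number to the nearest integer. -/
noncomputable def distNearestInt (x : ℝ) : ℝ :=
  |x - (round x : ℝ)|

/-- The set of limit values in `ℝ/ℤ` of the sequence of classes of `u k`, that is, the set of its
cluster points (equivalently, limits of convergent subsequences). -/
def limitValues (u : ℕ → ℝ) : Set UnitAddCircle :=
  {y | MapClusterPt y atTop (fun k => (u k : UnitAddCircle))}

/-- `S` is contained in an interval of `ℝ/ℤ` of length `< c`. Such an interval is the image of an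
interval of `ℝ` of the same length; closed ones suffice, as passing to the closure does not change
the length. -/
def InIntervalOfLengthLT (S : Set UnitAddCircle) (c : ℝ) : Prop :=
  ∃ a b : ℝ, a ≤ b ∧ b - a < c ∧ S ⊆ (fun t : ℝ => (t : UnitAddCircle)) '' Set.Icc a b

/-- The sequence `F(k) α ^ k + G(k)`. -/
noncomputable def expPolySeq (α : ℝ) (F G : ℝ[X]) (k : ℕ) : ℝ :=
  F.eval (k : ℝ) * α ^ k + G.eval (k : ℝ)

/-! ### Polynomials acting on sequences through the shift -/

section ShiftAction

/-! Let `X` act as the shift. Then `P ^ (f + 1)` kills `F(k) α ^ k`, and `(X - 1) ^ (g + 1)` kills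
`G(k)`. If a conclusion fails, there are integers `u k` at bounded distance from `x k`. For the
limsup, an operator of small length kills `x` and sends the error `x - u` below one in modulus, so
it sends `u` to integers that are eventually zero. For the residue classes modulo `M`, one factor `X
- 1` less makes the image of `x` constant; the image of `u` takes finitely many values, each
determined by a window of neighbours and the residue modulo `M`, so it is eventually periodic
(`exists_nearby_eventually_periodic`). Either way `u` is linear recurrent.

`not_bounded_error` excludes this by comparing spectral components. A bounded recurrent sequence has
no component at a root of modulus above one, and at most a simple one at a root on the unit circle.
So `u` has the component of `x` at `α`; being rational, it has components of at least that
multiplicity at every conjugate, where `x` has none. Hence the conjugates have modulus at most one,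
and below one if `F` is not constant. Fatou's lemma (`exists_monic_shiftAct_eq_zero`) makes `α` an
algebraic integer. The components at `α` and at `1` put the coefficients of `F` in `ℚ(α)` and the
nonconstant ones of `G` in `ℚ`. Each of the four conditions is contradicted.

The last conclusion rests on Weyl's method: after `P ^ (f + 1) * Q` only a polynomial sequence with
an irrational nonconstant coefficient remains, and it cannot stay in a short arc modulo one
(`not_eventually_near_of_not_mem_lifts`). -/

/-- The shift operator on sequences. -/
def seqShift (R : Type*) [CommRing R] : Module.End R (ℕ → R) where
  toFun u k := u (k + 1)
  map_add' _ _ := rfl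
  map_smul' _ _ := rfl

/-- The action of polynomials on sequences in which the variable acts as the shift. -/
noncomputable def shiftAct {R : Type*} [CommRing R] (p : R[X]) : Module.End R (ℕ → R) :=
  aeval (seqShift R) p

variable {R : Type*} [CommRing R]

lemma shiftAct_mul (p q : R[X]) (u : ℕ → R) :
    shiftAct (p * q) u = shiftAct p (shiftAct q u) := by
  simp [shiftAct]

lemma shiftAct_comm (p q : R[X]) (u : ℕ → R) :
    shiftAct p (shiftAct q u) = shiftAct q (shiftAct p u) := by
  rw [← shiftAct_mul, mul_comm, shiftAct_mul]

lemma shiftAct_add (p q : R[X]) (u : ℕ → R) :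
    shiftAct (p + q) u = shiftAct p u + shiftAct q u := by
  simp [shiftAct]

@[simp] lemma shiftAct_one (u : ℕ → R) : shiftAct (1 : R[X]) u = u := by
  simp [shiftAct]

lemma seqShift_pow_apply (n : ℕ) (u : ℕ → R) (k : ℕ) : (seqShift R ^ n) u k = u (k + n) := by
  induction n generalizing k with
  | zero => simp
  | succ n ih =>
    rw [pow_succ', Module.End.mul_apply]
    change (seqShift R ^ n) u (k + 1) = _
    rw [ih]; congr 1; ring

lemma shiftAct_apply (p : R[X]) (u : ℕ → R) (k : ℕ) :
    shiftAct p u k = ∑ i ∈ p.support, p.coeff i * u (k + i) := by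
  rw [shiftAct, aeval_eq_sum_range, LinearMap.sum_apply, Finset.sum_apply,
    ← Polynomial.sum_def (f := fun i a => a * u (k + i)), Polynomial.sum_over_range]
  · simp [seqShift_pow_apply]
  · simp

lemma shiftAct_apply_of_natDegree_lt {p : R[X]} {n : ℕ} (h : p.natDegree < n) (u : ℕ → R)
    (k : ℕ) : shiftAct p u k = ∑ i ∈ Finset.range n, p.coeff i * u (k + i) := by
  rw [shiftAct_apply, ← Polynomial.sum_def (f := fun i a => a * u (k + i)),
    Polynomial.sum_over_range' _ (by simp) n h]

lemma shiftAct_X_pow (n : ℕ) (u : ℕ → R) (k : ℕ) : shiftAct (X ^ n) u k = u (k + n) := by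
  simp [shiftAct, seqShift_pow_apply]

lemma shiftAct_X_sub_C (a : R) (u : ℕ → R) (k : ℕ) :
    shiftAct (X - C a) u k = u (k + 1) - a * u k := by
  simp [shiftAct, seqShift]

lemma shiftAct_map {S : Type*} [CommRing S] (φ : R →+* S) (p : R[X]) (u : ℕ → R) :
    shiftAct (p.map φ) (fun k => φ (u k)) = fun k => φ (shiftAct p u k) := by
  ext k
  rw [shiftAct_apply_of_natDegree_lt (Nat.lt_succ_of_le natDegree_map_le),
    shiftAct_apply_of_natDegree_lt (Nat.lt_succ_self _)]
  simp

lemma shiftAct_map_eq_zero {S : Type*} [CommRing S] (φ : R →+* S) {p : R[X]} {u : ℕ → R}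
    (h : shiftAct p u = 0) : shiftAct (p.map φ) (fun k => φ (u k)) = 0 := by
  rw [shiftAct_map, h]; ext k; simp

lemma shiftAct_eq_zero_of_dvd {p q : R[X]} {u : ℕ → R} (h : p ∣ q) (hp : shiftAct p u = 0) :
    shiftAct q u = 0 := by
  obtain ⟨r, rfl⟩ := h
  rw [mul_comm, shiftAct_mul, hp, map_zero]

lemma eq_shiftAct_of_isCoprime {p q a b : R[X]} (h : a * p + b * q = 1) {u : ℕ → R}
    (hq : shiftAct q u = 0) : u = shiftAct a (shiftAct p u) := by
  calc u = shiftAct (a * p + b * q) u := by rw [h, shiftAct_one]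
    _ = _ := by rw [shiftAct_add, shiftAct_mul, shiftAct_mul b, hq, map_zero, add_zero]

lemma eq_zero_of_isCoprime {p q : R[X]} (h : IsCoprime p q) {u : ℕ → R}
    (hp : shiftAct p u = 0) (hq : shiftAct q u = 0) : u = 0 := by
  obtain ⟨a, b, hab⟩ := h
  rw [eq_shiftAct_of_isCoprime hab hq, hp, map_zero]

lemma shiftAct_X_sub_C_pow_mul_pow (a : R) (h : R → R) (m : ℕ) :
    shiftAct ((X - C a) ^ m) (fun k : ℕ => h (k : R) * a ^ k) =
      fun k : ℕ => (fwdDiff (1 : R))^[m] h (k : R) * a ^ (k + m) := by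
  induction m with
  | zero => ext k; simp
  | succ m ih =>
    rw [pow_succ', shiftAct_mul, ih]
    ext k
    rw [shiftAct_X_sub_C, Function.iterate_succ_apply', fwdDiff]
    push_cast
    ring

lemma shiftAct_X_sub_C_pow_eval (a : R) (H : R[X]) {m : ℕ} (hm : H.natDegree < m) :
    shiftAct ((X - C a) ^ m) (fun k => H.eval (k : R) * a ^ k) = 0 := by
  rw [shiftAct_X_sub_C_pow_mul_pow a (fun t => H.eval t)]
  ext k
  have := congrFun (Polynomial.fwdDiff_iter_eq_zero_of_degree_lt hm) (k : R)
  simp only [Pi.zero_apply] at this ⊢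
  rw [this, zero_mul]

lemma shiftAct_X_sub_one_pow_eval (H : R[X]) {m : ℕ} (hm : H.natDegree < m) :
    shiftAct ((X - 1) ^ m) (fun k => H.eval (k : R)) = 0 := by
  simpa using shiftAct_X_sub_C_pow_eval 1 H hm

/-- The annihilator of `H(k) a ^ k` is generated by `(X - a) ^ (deg H + 1)`. -/
lemma X_sub_C_pow_dvd_of_shiftAct_eq_zero {K : Type*} [Field K] [CharZero K] {a : K} (ha : a ≠ 0)
    {H : K[X]} (hH : H ≠ 0) {D : K[X]}
    (hD : shiftAct D (fun k => H.eval (k : K) * a ^ k) = 0) :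
    (X - C a) ^ (H.natDegree + 1) ∣ D := by
  by_cases hD0 : D = 0
  · simp [hD0]
  obtain ⟨D₁, hD₁, hnd⟩ := exists_eq_pow_rootMultiplicity_mul_and_not_dvd D hD0 a
  set m := D.rootMultiplicity a
  by_contra hcon
  have hm : m ≤ H.natDegree := by
    by_contra hlt
    exact hcon (hD₁ ▸ (pow_dvd_pow _ (by omega)).mul_right _)
  set y : ℕ → K := fun k => H.eval (k : K) * a ^ k
  have h1 : shiftAct ((X - C a) ^ m) y = 0 := by
    refine eq_zero_of_isCoprime (p := D₁) (q := (X - C a) ^ (H.natDegree + 1)) ?_ ?_ ?_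
    · exact (((irreducible_X_sub_C a).coprime_iff_not_dvd).2 hnd).symm.pow_right
    · rw [← shiftAct_mul, mul_comm, ← hD₁, hD]
    · rw [shiftAct_comm, shiftAct_X_sub_C_pow_eval a H (Nat.lt_succ_self _), map_zero]
  -- This exponent is one too small: the top difference of `H` is its leading coefficient times a
  -- factorial, not zero.
  have h2 : shiftAct ((X - C a) ^ H.natDegree) y = 0 := shiftAct_eq_zero_of_dvd (pow_dvd_pow _ hm) h1
  have h3 := congrFun (shiftAct_X_sub_C_pow_mul_pow a (fun t => H.eval t) H.natDegree) 0
  have h4 := congrFun (Polynomial.fwdDiff_iter_degree_eq_factorial H) ((0 : ℕ) : K)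
  change shiftAct ((X - C a) ^ H.natDegree) y 0 = _ at h3
  rw [h2] at h3
  change (fwdDiff 1)^[H.natDegree] (fun t => H.eval t) ((0 : ℕ) : K) = _ at h4
  rw [h4] at h3
  simp [ha, hH, Nat.factorial_ne_zero] at h3

end ShiftAction

/-! ### Bounded sequences and their spectral components -/

section Bounded

/-- A sequence is norm-bounded. -/
def SeqBounded {K : Type*} [NormedField K] (u : ℕ → K) : Prop := ∃ c : ℝ, ∀ k, ‖u k‖ ≤ c

variable {K : Type*} [NormedField K]

lemma SeqBounded.polyShift {u : ℕ → K} (hu : SeqBounded u) (p : K[X]) :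
    SeqBounded (shiftAct p u) := by
  obtain ⟨c, hc⟩ := hu
  refine ⟨∑ i ∈ p.support, ‖p.coeff i‖ * c, fun k => ?_⟩
  rw [shiftAct_apply]
  refine (norm_sum_le _ _).trans (Finset.sum_le_sum fun i _ => ?_)
  rw [norm_mul]
  exact mul_le_mul_of_nonneg_left (hc _) (norm_nonneg _)

lemma apply_eq_pow_mul_of_shiftAct_eq_zero {a : K} {w : ℕ → K} (h : shiftAct (X - C a) w = 0)
    (k : ℕ) : w k = a ^ k * w 0 := by
  induction k with
  | zero => simp
  | succ k ih =>
    have := congrFun h k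
    rw [shiftAct_X_sub_C, Pi.zero_apply, sub_eq_zero] at this
    rw [this, ih]; ring

/-- Peeling off one factor leaves a geometric sequence of ratio `a`, which is bounded only if it
vanishes. -/
lemma SeqBounded.eq_zero_of_one_lt_norm {a : K} (ha : 1 < ‖a‖) {w : ℕ → K} (hw : SeqBounded w)
    {m : ℕ} (h : shiftAct ((X - C a) ^ m) w = 0) : w = 0 := by
  induction m with
  | zero => simpa using h
  | succ m ih =>
    apply ih
    rw [pow_succ', shiftAct_mul] at h
    obtain ⟨c, hc⟩ := hw.polyShift ((X - C a) ^ m)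
    set v := shiftAct ((X - C a) ^ m) w
    have h0 : v 0 = 0 := by
      by_contra hne
      obtain ⟨k, hk⟩ := ((tendsto_pow_atTop_atTop_of_one_lt ha).eventually_gt_atTop
        (c / ‖v 0‖)).exists
      have := hc k
      rw [apply_eq_pow_mul_of_shiftAct_eq_zero h k, norm_mul, norm_pow] at this
      rw [div_lt_iff₀ (norm_pos_iff.2 hne)] at hk
      linarith
    ext k
    rw [apply_eq_pow_mul_of_shiftAct_eq_zero h k, h0, mul_zero, Pi.zero_apply]

/-- A Jordan block of size two on the unit circle produces linear growth. The real algebra structure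
ensures that `‖(k : K)‖ = k`. -/
lemma SeqBounded.X_sub_C_eq_zero_of_sq [NormedAlgebra ℝ K] {a : K} (ha : ‖a‖ = 1)
    {w : ℕ → K} (hw : SeqBounded w) (h : shiftAct ((X - C a) ^ 2) w = 0) :
    shiftAct (X - C a) w = 0 := by
  rw [pow_two, shiftAct_mul] at h
  set y := shiftAct (X - C a) w with hy
  have hyk := apply_eq_pow_mul_of_shiftAct_eq_zero h
  have ha0 : a ≠ 0 := by rintro rfl; simp at ha
  -- The factor `a` on the left avoids the exponent `k - 1`.
  have hwk : ∀ k : ℕ, a * w k = a ^ k * (a * w 0 + k * y 0) := by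
    intro k
    induction k with
    | zero => simp
    | succ k ih =>
      have h1 := hyk k
      rw [hy, shiftAct_X_sub_C, ← hy] at h1
      have h2 : w (k + 1) = a * w k + a ^ k * y 0 := by rw [← h1]; ring
      rw [h2, ih]; push_cast; ring
  have h0 : y 0 = 0 := by
    by_contra hne
    obtain ⟨c, hc⟩ := hw
    obtain ⟨k, hk⟩ := exists_nat_gt ((c + c) / ‖y 0‖)
    rw [div_lt_iff₀ (norm_pos_iff.2 hne)] at hk
    have h1 : (k : K) * y 0 = a * w k / a ^ k - a * w 0 := by
      rw [hwk]; field_simp; ring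
    have h2 : ‖(k : K) * y 0‖ ≤ c + c := by
      rw [h1]
      refine (norm_sub_le _ _).trans (add_le_add ?_ ?_) <;> simp [ha, hc]
    have hkn : ‖(k : K)‖ = k := by
      rw [← map_natCast (algebraMap ℝ K) k, norm_algebraMap']; simp
    rw [norm_mul, hkn] at h2
    linarith
  ext k
  rw [hyk, h0, mul_zero, Pi.zero_apply]

lemma SeqBounded.X_sub_C_eq_zero [NormedAlgebra ℝ K] {a : K} (ha : ‖a‖ = 1)
    {w : ℕ → K} (hw : SeqBounded w) {m : ℕ} (h : shiftAct ((X - C a) ^ m) w = 0) :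
    shiftAct (X - C a) w = 0 := by
  induction m with
  | zero =>
    rw [pow_zero, shiftAct_one] at h
    rw [h, map_zero]
  | succ m ih =>
    rcases m with _ | m
    · simpa using h
    · apply ih
      rw [show m + 1 + 1 = 2 + m by ring, pow_add, shiftAct_mul] at h
      rw [pow_succ', shiftAct_mul]
      exact (hw.polyShift _).X_sub_C_eq_zero_of_sq ha h

end Bounded

/-! ### Minimal recurrences, Fatou's lemma and fields of definition -/

section Annihilator

/-- The ideal of polynomials annihilating a sequence. -/
noncomputable def seqAnnihilator {K : Type*} [CommRing K] (u : ℕ → K) : Ideal K[X] where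
  carrier := {p | shiftAct p u = 0}
  zero_mem' := by simp [shiftAct]
  add_mem' {p q} hp hq := by
    change shiftAct (p + q) u = 0
    rw [shiftAct_add, hp, hq, add_zero]
  smul_mem' c p hp := by
    change shiftAct (c * p) u = 0
    rw [shiftAct_mul, hp, map_zero]

lemma exists_seqAnnihilator_generator {K : Type*} [Field K] {u : ℕ → K} {B : K[X]} (hB0 : B ≠ 0)
    (hB : shiftAct B u = 0) :
    ∃ B₀ : K[X], B₀ ≠ 0 ∧ shiftAct B₀ u = 0 ∧ ∀ D, shiftAct D u = 0 → B₀ ∣ D := by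
  have key : ∀ D, shiftAct D u = 0 ↔ Submodule.IsPrincipal.generator (seqAnnihilator u) ∣ D :=
    fun D => Submodule.IsPrincipal.mem_iff_generator_dvd (seqAnnihilator u)
  refine ⟨_, ?_, (key _).2 dvd_rfl, fun D => (key D).1⟩
  intro h0
  have := (key B).1 hB
  rw [h0, zero_dvd_iff] at this
  exact hB0 this

/-- A generator of the annihilator stays one after extension of scalars. -/
lemma map_dvd_of_shiftAct_eq_zero {K L : Type*} [Field K] [Field L] [Algebra K L] {u : ℕ → K}
    {B : K[X]} (hB0 : B ≠ 0) (hB : shiftAct B u = 0) (hgen : ∀ D, shiftAct D u = 0 → B ∣ D)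
    {p : L[X]} (hp : shiftAct p (fun k => algebraMap K L (u k)) = 0) :
    B.map (algebraMap K L) ∣ p := by
  set BL := B.map (algebraMap K L) with hBL
  have hBL0 : BL ≠ 0 := Polynomial.map_ne_zero hB0
  set r := p % BL with hr
  have hru : shiftAct r (fun k => algebraMap K L (u k)) = 0 := by
    have h1 := EuclideanDomain.mod_add_div p BL
    rw [← h1, shiftAct_add, shiftAct_eq_zero_of_dvd (Dvd.intro _ rfl)
      (shiftAct_map_eq_zero _ hB), add_zero] at hp
    exact hp
  have hdeg : r.degree < B.degree := by
    rw [← degree_map B (algebraMap K L)]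
    exact EuclideanDomain.mod_lt p hBL0
  rw [← EuclideanDomain.mod_eq_zero, ← hr]
  ext i
  -- A `K`-linear functional applied to the coefficients of the remainder gives an annihilator of
  -- `u` over `K` of degree below that of `B`, hence zero; functionals separate the points of `L`.
  rw [coeff_zero, ← Module.forall_dual_apply_eq_zero_iff K]
  intro φ
  set d := B.natDegree
  set r' : K[X] := ∑ j ∈ Finset.range d, C (φ (r.coeff j)) * X ^ j with hr'
  have hcoeff : ∀ j, r'.coeff j = if j < d then φ (r.coeff j) else 0 := by
    intro j
    rw [hr', finsetSum_coeff]
    simp [coeff_C_mul, coeff_X_pow]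
  have hr'deg : r'.degree < B.degree := by
    rw [degree_eq_natDegree hB0, degree_lt_iff_coeff_zero]
    intro j hj
    rw [hcoeff, if_neg (by omega)]
  have hrn : ∀ j, ¬ j < d → r.coeff j = 0 := by
    intro j hj
    rw [degree_eq_natDegree hB0, degree_lt_iff_coeff_zero] at hdeg
    exact hdeg j (by omega)
  have hr'u : shiftAct r' u = 0 := by
    ext k
    have h1 : r'.natDegree < d + 1 := by
      refine Nat.lt_succ_of_le (natDegree_le_iff_coeff_eq_zero.2 fun j hj => ?_)
      rw [hcoeff, if_neg (by omega)]
    have h2 : r.natDegree < d + 1 :=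
      Nat.lt_succ_of_le (natDegree_le_iff_coeff_eq_zero.2 fun j hj => hrn j (by omega))
    have h3 := congrFun hru k
    rw [shiftAct_apply_of_natDegree_lt h2, Pi.zero_apply] at h3
    have h4 := congrArg φ h3
    rw [map_sum, map_zero] at h4
    rw [shiftAct_apply_of_natDegree_lt h1, Pi.zero_apply, ← h4]
    refine Finset.sum_congr rfl fun j _ => ?_
    rw [hcoeff, mul_comm (r.coeff j), ← Algebra.smul_def, map_smul, smul_eq_mul, mul_comm]
    split_ifs with hj
    · rfl
    · rw [hrn j hj, map_zero]
  have h0 : r' = 0 := eq_zero_of_dvd_of_degree_lt (hgen r' hr'u) hr'deg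
  by_cases hi : i < d
  · have := hcoeff i
    rw [if_pos hi, h0, coeff_zero] at this
    exact this.symm
  · rw [hrn i hi, map_zero]

/-- An integer sequence satisfying some linear recurrence satisfies one with monic integer
characteristic polynomial. -/
lemma exists_monic_shiftAct_eq_zero {u : ℕ → ℤ} {B : ℤ[X]} (hB0 : B ≠ 0)
    (hB : shiftAct B u = 0) : ∃ q : ℤ[X], q.Monic ∧ shiftAct q u = 0 := by
  -- `N` is spanned by the shifts of `u`. The first `d` terms determine an element of `N`, so `N`
  -- embeds in `ℤ ^ d` and is finitely generated; the shift on `N` is therefore integral over `ℤ`.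
  let N : Submodule ℤ (ℕ → ℤ) := LinearMap.range
    ((LinearMap.applyₗ u).comp (aeval (seqShift ℤ) : ℤ[X] →ₐ[ℤ] _).toLinearMap)
  have hN : ∀ v, v ∈ N ↔ ∃ p : ℤ[X], shiftAct p u = v := fun v => Iff.rfl
  let d := B.natDegree
  let π : N →ₗ[ℤ] (Fin d → ℤ) :=
    (LinearMap.pi fun i : Fin d => LinearMap.proj (i : ℕ)).comp N.subtype
  have hπ : Function.Injective π := by
    rw [← LinearMap.ker_eq_bot, LinearMap.ker_eq_bot']
    rintro ⟨v, hv⟩ h0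
    obtain ⟨p, rfl⟩ := (hN v).1 hv
    have hBv : shiftAct B (shiftAct p u) = 0 := by rw [shiftAct_comm, hB, map_zero]
    set v := shiftAct p u
    have hz : ∀ k, v k = 0 := by
      intro k
      induction k using Nat.strong_induction_on with
      | _ k ih =>
        by_cases hk : k < d
        · exact congrFun h0 (⟨k, hk⟩ : Fin d)
        · have h1 := congrFun hBv (k - d)
          rw [shiftAct_apply_of_natDegree_lt (Nat.lt_succ_self d), Finset.sum_range_succ,
            Finset.sum_eq_zero, zero_add, Nat.sub_add_cancel (by omega), Pi.zero_apply] at h1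
          · exact (mul_eq_zero.1 h1).resolve_left (by simpa [d] using hB0)
          · intro i hi
            rw [Finset.mem_range] at hi
            rw [ih _ (by omega), mul_zero]
    ext k
    exact hz k
  have hfin : Module.Finite ℤ N := by
    have := isNoetherian_of_injective π hπ
    infer_instance
  have hT : ∀ v ∈ N, seqShift ℤ v ∈ N := by
    intro v hv
    obtain ⟨p, rfl⟩ := (hN v).1 hv
    refine (hN _).2 ⟨X * p, ?_⟩
    rw [shiftAct_mul]
    simp [shiftAct]
  obtain ⟨q, hq, hq0⟩ := Algebra.IsIntegral.isIntegral (R := ℤ) ((seqShift ℤ).restrict hT)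
  refine ⟨q, hq, ?_⟩
  have hres : ∀ (p : ℤ[X]) (v : N), ((aeval ((seqShift ℤ).restrict hT) p v : N) : ℕ → ℤ) =
      shiftAct p v := by
    intro p v
    induction p using Polynomial.induction_on' generalizing v with
    | add p q hp hq => simp [shiftAct_add, hp, hq]
    | monomial n a =>
      simp only [shiftAct, aeval_monomial, Module.End.mul_apply, Module.algebraMap_end_apply,
        Submodule.coe_smul]
      congr 1
      induction n generalizing v with
      | zero => simp
      | succ n ih => rw [pow_succ, pow_succ, Module.End.mul_apply, Module.End.mul_apply, ih]; rfl
  have := hres q ⟨u, (hN u).2 ⟨1, shiftAct_one u⟩⟩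
  rw [← this]
  change aeval _ q = 0 at hq0
  rw [hq0]
  rfl

/-- A polynomial with values in a subfield at the natural numbers has coefficients there. -/
lemma mem_lifts_of_eval_natCast {K L : Type*} [Field K] [Field L] [CharZero L] [Algebra K L]
    {F : L[X]} (h : ∀ k : ℕ, ∃ r : K, F.eval (k : L) = algebraMap K L r) :
    F ∈ lifts (algebraMap K L) := by
  choose r hr using h
  have hK : CharZero K := (algebraMap K L).charZero
  have hinj : Set.InjOn (fun i : ℕ => (i : K)) (Finset.range (F.natDegree + 1)) :=
    Nat.cast_injective.injOn
  have hinjL : Set.InjOn (fun i : ℕ => (i : L)) (Finset.range (F.natDegree + 1)) :=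
    Nat.cast_injective.injOn
  set I := Lagrange.interpolate (Finset.range (F.natDegree + 1)) (fun i : ℕ => (i : K)) r
  refine ⟨I, ?_⟩
  refine eq_of_degrees_lt_of_eval_index_eq _ hinjL ?_ ?_ ?_
  · change (I.map (algebraMap K L)).degree < _
    rw [degree_map]
    exact Lagrange.degree_interpolate_lt _ hinj
  · rw [Finset.card_range]
    exact degree_le_natDegree.trans_lt (by exact_mod_cast Nat.lt_succ_self _)
  · intro i hi
    change (I.map (algebraMap K L)).eval _ = _
    rw [eval_natCast_map, Lagrange.eval_interpolate_at_node r hinj hi, hr]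

end Annihilator

/-! ### Recurrent integer sequences at bounded distance from `F(k) α ^ k + G(k)` -/

section Approximation

variable {α : ℝ} {F G : ℝ[X]} {u : ℕ → ℤ}

lemma expPolySeq_eq_add (α : ℝ) (F G : ℝ[X]) :
    expPolySeq α F G = (fun k : ℕ => F.eval (k : ℝ) * α ^ k) + fun k : ℕ => G.eval (k : ℝ) := rfl

lemma shiftAct_expPolySeq (α : ℝ) (F G : ℝ[X]) (D : ℝ[X]) :
    shiftAct D (expPolySeq α F G) = shiftAct D (fun k : ℕ => F.eval (k : ℝ) * α ^ k) +
      shiftAct D (fun k : ℕ => G.eval (k : ℝ)) := by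
  rw [expPolySeq_eq_add, map_add]

lemma shiftAct_expPolySeq_eq_zero (α : ℝ) (F G : ℝ[X]) :
    shiftAct ((X - C α) ^ (F.natDegree + 1) * (X - 1) ^ (G.natDegree + 1)) (expPolySeq α F G)
      = 0 := by
  rw [shiftAct_expPolySeq,
    shiftAct_eq_zero_of_dvd (Dvd.intro _ rfl) (shiftAct_X_sub_C_pow_eval α F (Nat.lt_succ_self _)),
    shiftAct_eq_zero_of_dvd (Dvd.intro_left _ rfl)
      (shiftAct_X_sub_one_pow_eval G (Nat.lt_succ_self _)), add_zero]

lemma ne_one_of_one_lt_abs (hα : 1 < |α|) : α ≠ 1 := by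
  rintro rfl; simp at hα

lemma ne_zero_of_one_lt_abs (hα : 1 < |α|) : α ≠ 0 := by
  rintro rfl; simp at hα; linarith

/-- If the error of approximation is bounded, an operator applied to the error that involves
`(X - 1) ^ (deg G + 1)` and annihilates the integer sequence up to a power of `X - α` kills it. -/
lemma shiftAct_error_eq_zero (hα : 1 < |α|)
    (hε : SeqBounded (fun k => expPolySeq α F G k - (u k : ℝ))) {D : ℝ[X]} {m : ℕ}
    (hD : shiftAct ((X - C α) ^ m * D) (fun k => (u k : ℝ)) = 0)
    {j : ℕ} (hx : shiftAct ((X - C α) ^ j * D) (expPolySeq α F G) = 0) :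
    shiftAct D (expPolySeq α F G) = shiftAct D (fun k => (u k : ℝ)) := by
  have h1 : shiftAct D (fun k => expPolySeq α F G k - (u k : ℝ)) = 0 := by
    refine (hε.polyShift D).eq_zero_of_one_lt_norm (a := α) (m := m + j) (by simpa using hα) ?_
    change shiftAct _ (shiftAct D (expPolySeq α F G - fun k => (u k : ℝ))) = 0
    rw [← shiftAct_mul, map_sub,
      shiftAct_eq_zero_of_dvd (p := (X - C α) ^ m * D) ⟨(X - C α) ^ j, by ring⟩ hD,
      shiftAct_eq_zero_of_dvd (p := (X - C α) ^ j * D) ⟨(X - C α) ^ m, by ring⟩ hx, sub_zero]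
  change shiftAct D (expPolySeq α F G - fun k => (u k : ℝ)) = 0 at h1
  rwa [map_sub, sub_eq_zero] at h1

lemma isCoprime_X_sub_C_X_sub_one {K : Type*} [Field K] {a : K} (ha : a ≠ 1) (m n : ℕ) :
    IsCoprime ((X - C a) ^ m) ((X - 1 : K[X]) ^ n) := by
  have := (isCoprime_X_sub_C_of_isUnit_sub (sub_ne_zero.2 ha).isUnit).pow (m := m) (n := n)
  rwa [C_1] at this

/-- Every annihilator of the integer sequence is divisible by `(X - α) ^ (deg F + 1)`. -/
lemma X_sub_C_pow_dvd_of_annihilates (hα : 1 < |α|) (hF : F ≠ 0)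
    (hε : SeqBounded (fun k => expPolySeq α F G k - (u k : ℝ))) {D : ℝ[X]}
    (hD : shiftAct D (fun k => (u k : ℝ)) = 0) : (X - C α) ^ (F.natDegree + 1) ∣ D := by
  -- The factor `(X - 1) ^ (G.natDegree + 1)` removes `G` and, being coprime to `X - α`, can be
  -- cancelled at the end.
  have h1 : shiftAct ((X - 1) ^ (G.natDegree + 1) * D) (expPolySeq α F G) = 0 := by
    rw [shiftAct_error_eq_zero (m := 0) (j := F.natDegree + 1) hα hε]
    · exact shiftAct_eq_zero_of_dvd (Dvd.intro_left _ rfl) hD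
    · exact shiftAct_eq_zero_of_dvd ⟨(X - 1) ^ (G.natDegree + 1), by ring⟩ hD
    · exact shiftAct_eq_zero_of_dvd ⟨D, by ring⟩ (shiftAct_expPolySeq_eq_zero α F G)
  rw [shiftAct_expPolySeq, shiftAct_eq_zero_of_dvd (Dvd.intro _ rfl)
    (shiftAct_X_sub_one_pow_eval G (Nat.lt_succ_self _)), add_zero] at h1
  have h2 := X_sub_C_pow_dvd_of_shiftAct_eq_zero (ne_zero_of_one_lt_abs hα) hF h1
  exact (isCoprime_X_sub_C_X_sub_one (ne_one_of_one_lt_abs hα) _ _).dvd_of_dvd_mul_left h2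

/-- Fatou's lemma gives a monic integer annihilator of `u`, and every annihilator of `u` vanishes at
`α`. -/
lemma isIntegral_of_bounded_error (hα : 1 < |α|) (hF : F ≠ 0)
    (hε : SeqBounded (fun k => expPolySeq α F G k - (u k : ℝ))) {B : ℤ[X]} (hB0 : B ≠ 0)
    (hB : shiftAct B u = 0) : IsIntegral ℤ α := by
  obtain ⟨q, hq, hqu⟩ := exists_monic_shiftAct_eq_zero hB0 hB
  refine ⟨q, hq, ?_⟩
  have h1 := X_sub_C_pow_dvd_of_annihilates hα hF hε
    (shiftAct_map_eq_zero (Int.castRingHom ℝ) hqu)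
  have h2 : (X - C α) ∣ q.map (Int.castRingHom ℝ) := (dvd_pow_self _ (Nat.succ_ne_zero _)).trans h1
  rw [dvd_iff_isRoot, IsRoot, eval_map] at h2
  exact h2

/-- A rational polynomial vanishes at `α` to the same order as it does at its conjugates. -/
lemma minpoly_pow_dvd (hα : IsIntegral ℚ α) {B : ℚ[X]} {m : ℕ} (hB0 : B ≠ 0)
    (h : (X - C α) ^ m ∣ B.map (algebraMap ℚ ℝ)) : minpoly ℚ α ^ m ∣ B := by
  set p := minpoly ℚ α
  have hirr : Irreducible p := minpoly.irreducible hα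
  obtain ⟨D, hD, hnd⟩ := (FiniteMultiplicity.of_prime_left hirr.prime hB0).exists_eq_pow_mul_and_not_dvd
  set n := multiplicity p B
  by_cases hmn : m ≤ n
  · exact hD ▸ (pow_dvd_pow _ hmn).mul_right _
  exfalso
  obtain ⟨p₁, hp₁⟩ : (X - C α) ∣ p.map (algebraMap ℚ ℝ) := by
    rw [dvd_iff_isRoot, IsRoot, eval_map_algebraMap]
    exact minpoly.aeval ℚ α
  -- By separability `α` is a simple root of `p`, so `B` vanishes at `α` to order exactly `n`.
  have hsep : (p.map (algebraMap ℚ ℝ)).Separable := hirr.separable.map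
  rw [hp₁] at hsep
  have hp₁α : ¬ (X - C α) ∣ p₁ :=
    (irreducible_X_sub_C α).coprime_iff_not_dvd.1 hsep.isCoprime
  have hDα : ¬ (X - C α) ∣ D.map (algebraMap ℚ ℝ) := by
    rw [dvd_iff_isRoot, IsRoot, eval_map_algebraMap]
    exact fun h0 => hnd (minpoly.dvd ℚ α h0)
  have h1 : (X - C α) ^ n * (X - C α) ∣ (X - C α) ^ n * (p₁ ^ n * D.map (algebraMap ℚ ℝ)) := by
    rw [← pow_succ]
    refine (pow_dvd_pow _ (by omega)).trans (h.trans (dvd_of_eq ?_))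
    conv_lhs => rw [hD]
    rw [Polynomial.map_mul, Polynomial.map_pow, hp₁, mul_pow]
    ring
  have h2 := (mul_dvd_mul_iff_left (pow_ne_zero _ (X_sub_C_ne_zero α))).1 h1
  rcases (prime_X_sub_C α).dvd_or_dvd h2 with h3 | h3
  · exact hp₁α ((prime_X_sub_C α).dvd_of_dvd_pow h3)
  · exact hDα h3

lemma SeqBounded.ofReal {w : ℕ → ℝ} (hw : SeqBounded w) : SeqBounded (fun k => (w k : ℂ)) := by
  obtain ⟨c, hc⟩ := hw
  exact ⟨c, fun k => by simpa using hc k⟩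

/-- The conjugates of `α` have modulus at most one, and less than one if `F` is not constant. -/
lemma norm_conj_le_of_bounded_error (hα : 1 < |α|) (hF : F ≠ 0)
    (hε : SeqBounded (fun k => expPolySeq α F G k - (u k : ℝ))) {B : ℤ[X]} (hB0 : B ≠ 0)
    (hB : shiftAct B u = 0) (hint : IsIntegral ℚ α) {z : ℂ} (hz : aeval z (minpoly ℚ α) = 0)
    (hzα : z ≠ (α : ℂ)) : ‖z‖ ≤ 1 ∧ (0 < F.natDegree → ‖z‖ < 1) := by
  -- The generator is taken over `ℚ` so that its order at `α` passes to the conjugates; it still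
  -- generates the annihilator over `ℂ`.
  obtain ⟨B₀, hB₀0, hB₀u, hgen⟩ := exists_seqAnnihilator_generator
    (u := fun k => (u k : ℚ)) ((Polynomial.map_ne_zero_iff (f := Int.castRingHom ℚ)
      Int.cast_injective).2 hB0 : B.map (Int.castRingHom ℚ) ≠ 0)
    (shiftAct_map_eq_zero (Int.castRingHom ℚ) hB)
  have hB₀R : shiftAct (B₀.map (algebraMap ℚ ℝ)) (fun k => (u k : ℝ)) = 0 := by
    simpa using shiftAct_map_eq_zero (algebraMap ℚ ℝ) hB₀u
  have hpow := minpoly_pow_dvd hint hB₀0 (X_sub_C_pow_dvd_of_annihilates hα hF hε hB₀R)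
  set BC := B₀.map (algebraMap ℚ ℂ) with hBC
  have hBC0 : BC ≠ 0 := Polynomial.map_ne_zero hB₀0
  have hzB : (X - C z) ^ (F.natDegree + 1) ∣ BC := by
    have h1 : (minpoly ℚ α ^ (F.natDegree + 1)).map (algebraMap ℚ ℂ) ∣ BC :=
      Polynomial.map_dvd _ hpow
    refine dvd_trans ?_ h1
    rw [Polynomial.map_pow]
    refine pow_dvd_pow_of_dvd ?_ _
    rwa [dvd_iff_isRoot, IsRoot, eval_map_algebraMap]
  have hz1 : z ≠ 1 := by
    rintro rfl
    have h1 : (minpoly ℚ α).IsRoot 1 := by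
      have h2 : aeval (algebraMap ℚ ℂ 1) (minpoly ℚ α) = 0 := by simpa using hz
      rw [aeval_algebraMap_apply] at h2
      simpa using h2
    have h3 := minpoly.root hint h1
    exact ne_one_of_one_lt_abs hα (by simpa using h3.symm)
  set Z : ℂ[X] := (X - C (α : ℂ)) ^ (F.natDegree + 1) * (X - 1) ^ (G.natDegree + 1) with hZ
  have hZz : ¬ (X - C z) ∣ Z := by
    rw [dvd_iff_isRoot, IsRoot, hZ]
    simp [sub_eq_zero, hzα, hz1]
  set x : ℕ → ℂ := fun k => (expPolySeq α F G k : ℂ) with hx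
  set uC : ℕ → ℂ := fun k => (u k : ℂ) with huC
  have hZx : shiftAct Z x = 0 := by
    have := shiftAct_map_eq_zero Complex.ofRealHom (shiftAct_expPolySeq_eq_zero α F G)
    simpa [hZ] using this
  have hbd : SeqBounded (x - uC) := by
    have := hε.ofReal
    simp only [Complex.ofReal_sub, Complex.ofReal_intCast] at this
    exact this
  have hBCu : shiftAct BC uC = 0 := by
    simpa using shiftAct_map_eq_zero (algebraMap ℚ ℂ) hB₀u
  have hBCdvd : ∀ D : ℂ[X], shiftAct D uC = 0 → BC ∣ D := by
    intro D hD
    exact map_dvd_of_shiftAct_eq_zero hB₀0 hB₀u hgen (by simpa using hD)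
  obtain ⟨D, hD, hnd⟩ := exists_eq_pow_rootMultiplicity_mul_and_not_dvd BC hBC0 z
  set m := BC.rootMultiplicity z
  -- `Z * D` kills `x` and reduces the error to its component at `z`, up to an invertible factor
  -- since `X - z` does not divide `Z * D`.
  have hkill : shiftAct ((X - C z) ^ m) (shiftAct (Z * D) (x - uC)) = 0 := by
    rw [← shiftAct_mul, map_sub, shiftAct_eq_zero_of_dvd (p := Z) ⟨(X - C z) ^ m * D, by ring⟩ hZx,
      shiftAct_eq_zero_of_dvd (p := BC) ⟨Z, by rw [hD]; ring⟩ hBCu, sub_zero]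
  have hZDx : shiftAct (Z * D) x = 0 := shiftAct_eq_zero_of_dvd (Dvd.intro _ rfl) hZx
  have hndZD : ¬ (X - C z) ∣ Z * D := fun h => ((prime_X_sub_C z).dvd_or_dvd h).elim hZz hnd
  have hle : ‖z‖ ≤ 1 := by
    by_contra! hlt
    have h1 := (hbd.polyShift (Z * D)).eq_zero_of_one_lt_norm hlt hkill
    rw [map_sub, hZDx, zero_sub, neg_eq_zero] at h1
    exact hndZD ((dvd_pow_self _ (Nat.succ_ne_zero _)).trans (hzB.trans (hBCdvd _ h1)))
  refine ⟨hle, fun hf => lt_of_le_of_ne hle fun h1 => ?_⟩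
  -- On the unit circle the component is at most simple, whereas `B₀` vanishes at `z` to order at
  -- least two.
  have h2 := (hbd.polyShift (Z * D)).X_sub_C_eq_zero h1 hkill
  rw [map_sub, hZDx, zero_sub, map_neg, neg_eq_zero, ← shiftAct_mul] at h2
  have h3 : (X - C z) * (X - C z) ∣ (X - C z) * (Z * D) := by
    rw [← pow_two]
    exact (pow_dvd_pow _ (by omega)).trans (hzB.trans (hBCdvd _ h2))
  exact hndZD ((mul_dvd_mul_iff_left (X_sub_C_ne_zero z)).1 h3)

/-- The coefficients of `F` lie in any field of definition of `α`. -/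
lemma mem_lifts_of_bounded_error {K : Type*} [Field K] [Algebra K ℝ] {a : K}
    (ha : algebraMap K ℝ a = α) (hα : 1 < |α|)
    (hε : SeqBounded (fun k => expPolySeq α F G k - (u k : ℝ))) {B : ℤ[X]} (hB0 : B ≠ 0)
    (hB : shiftAct B u = 0) : F ∈ lifts (algebraMap K ℝ) := by
  have hK : CharZero K := (algebraMap K ℝ).charZero
  have ha1 : a ≠ 1 := by
    rintro rfl
    exact ne_one_of_one_lt_abs hα (by simpa using ha.symm)
  have hBK0 : B.map (Int.castRingHom K) ≠ 0 :=
    (Polynomial.map_ne_zero_iff Int.cast_injective).2 hB0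
  have hBK := shiftAct_map_eq_zero (Int.castRingHom K) hB
  obtain ⟨B₁, hB₁, hnd⟩ := exists_eq_pow_rootMultiplicity_mul_and_not_dvd _ hBK0 a
  set m := (B.map (Int.castRingHom K)).rootMultiplicity a
  set n := G.natDegree + 1
  set f := F.natDegree + 1
  set D : K[X] := (X - 1) ^ n * B₁
  have hcop : IsCoprime D ((X - C a) ^ f) := by
    refine IsCoprime.mul_left (isCoprime_X_sub_C_X_sub_one ha1 _ _).symm ?_
    exact (((irreducible_X_sub_C a).coprime_iff_not_dvd).2 hnd).symm.pow_right
  -- `D` removes all components except the one at `α`, where `s` inverts it; thus `F(k) α ^ k` is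
  -- recovered from `u` with coefficients in `K`.
  obtain ⟨s, t, hst⟩ := hcop
  set φ := algebraMap K ℝ
  have hDu : shiftAct ((X - C α) ^ m * D.map φ) (fun k => (u k : ℝ)) = 0 := by
    have h1 : shiftAct ((X - C a) ^ m * D) (fun k => (u k : K)) = 0 := by
      refine shiftAct_eq_zero_of_dvd ⟨(X - 1) ^ n, ?_⟩ hBK
      rw [hB₁]; ring
    have h2 := shiftAct_map_eq_zero φ h1
    simpa [ha] using h2
  set y : ℕ → ℝ := fun k => F.eval (k : ℝ) * α ^ k with hy
  have hDmap : D.map φ = (X - 1) ^ n * B₁.map φ := by simp [D]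
  have hDG : shiftAct (D.map φ) (fun k : ℕ => G.eval (k : ℝ)) = 0 := by
    rw [hDmap]
    exact shiftAct_eq_zero_of_dvd (Dvd.intro _ rfl)
      (shiftAct_X_sub_one_pow_eval G (Nat.lt_succ_self _))
  have hDy : shiftAct (D.map φ) y = shiftAct (D.map φ) (fun k => (u k : ℝ)) := by
    rw [← shiftAct_error_eq_zero hα hε hDu (j := f)]
    · rw [shiftAct_expPolySeq, hDG, add_zero]
    · refine shiftAct_eq_zero_of_dvd ⟨B₁.map φ, ?_⟩ (shiftAct_expPolySeq_eq_zero α F G)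
      rw [hDmap]; ring
  have hyeq : y = shiftAct (s.map φ) (shiftAct (D.map φ) y) := by
    refine eq_shiftAct_of_isCoprime (q := ((X - C a) ^ f).map φ) (b := t.map φ) ?_ ?_
    · rw [← Polynomial.map_mul, ← Polynomial.map_mul, ← Polynomial.map_add, hst, Polynomial.map_one]
    · simpa [ha] using shiftAct_X_sub_C_pow_eval α F (Nat.lt_succ_self _)
  have huφ : (fun k => (u k : ℝ)) = fun k => φ (u k : K) := by ext k; simp
  rw [hDy, ← shiftAct_mul, ← Polynomial.map_mul, huφ, shiftAct_map] at hyeq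
  refine mem_lifts_of_eval_natCast fun k => ⟨shiftAct (s * D) (fun k => (u k : K)) k / a ^ k, ?_⟩
  have h1 := congrFun hyeq k
  rw [map_div₀, map_pow, ha, ← h1, hy]
  field_simp [ne_zero_of_one_lt_abs hα]

/-- If an operator with rational coefficients and nonzero coefficient sum maps the differences of
`G` to a rational sequence, then the nonconstant coefficients of `G` are rational. -/
lemma sub_C_mem_lifts_of_shiftAct_rational {D : ℚ[X]} (hD : ¬ (X - 1) ∣ D) {r : ℕ → ℚ}
    (h : shiftAct (D.map (algebraMap ℚ ℝ) * (X - 1)) (fun k : ℕ => G.eval (k : ℝ)) =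
      fun k => (r k : ℝ)) : G - C (G.eval 0) ∈ lifts (algebraMap ℚ ℝ) := by
  set φ := algebraMap ℚ ℝ
  have hcop : IsCoprime D ((X - 1) ^ (G.natDegree + 1)) := by
    rw [← C_1] at hD ⊢
    exact (((irreducible_X_sub_C (1 : ℚ)).coprime_iff_not_dvd).2 hD).symm.pow_right
  -- The operator `s` inverts `D` on the differences of `G`, which are therefore rational; summing
  -- them gives `G(k) - G(0)`.
  obtain ⟨s, t, hst⟩ := hcop
  have h1 := eq_shiftAct_of_isCoprime (p := D.map φ) (q := ((X - 1 : ℚ[X]) ^ (G.natDegree + 1)).map φ)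
    (a := s.map φ) (b := t.map φ) (u := shiftAct (X - 1) (fun k : ℕ => G.eval (k : ℝ)))
    (by rw [← Polynomial.map_mul, ← Polynomial.map_mul, ← Polynomial.map_add, hst,
      Polynomial.map_one])
    (by
      rw [shiftAct_comm]
      have := shiftAct_X_sub_one_pow_eval G (Nat.lt_succ_self _)
      simp only [Polynomial.map_pow, Polynomial.map_sub, Polynomial.map_X, Polynomial.map_one]
      rw [this, map_zero])
  rw [← shiftAct_mul (D.map φ), h] at h1
  have h2 := shiftAct_map φ s r
  change shiftAct (s.map φ) (fun k => (r k : ℝ)) = _ at h2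
  rw [h2] at h1
  have h3 : ∀ k : ℕ, ∃ q : ℚ, G.eval (k : ℝ) - G.eval 0 = φ q := by
    intro k
    induction k with
    | zero => exact ⟨0, by simp⟩
    | succ k ih =>
      obtain ⟨q, hq⟩ := ih
      have h4 := congrFun h1 k
      rw [← C_1, shiftAct_X_sub_C] at h4
      refine ⟨q + shiftAct s r k, ?_⟩
      rw [map_add, ← hq, ← h4]; ring
  exact mem_lifts_of_eval_natCast fun k => by simpa using h3 k

/-- Once the other components are removed, the bounded error has only a simple component at `1`. One
more `X - 1` kills it, so the differences of `G` and of `u` have the same image under a rational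
operator. -/
lemma sub_C_mem_lifts_of_bounded_error (hα : 1 < |α|) (hint : IsIntegral ℚ α)
    (hε : SeqBounded (fun k => expPolySeq α F G k - (u k : ℝ))) {B : ℤ[X]} (hB0 : B ≠ 0)
    (hB : shiftAct B u = 0) : G - C (G.eval 0) ∈ lifts (algebraMap ℚ ℝ) := by
  set φ := algebraMap ℚ ℝ
  set p := minpoly ℚ α ^ (F.natDegree + 1)
  have hp : (X - C α) ^ (F.natDegree + 1) ∣ p.map φ := by
    rw [Polynomial.map_pow]
    refine pow_dvd_pow_of_dvd ?_ _
    rw [dvd_iff_isRoot, IsRoot, eval_map_algebraMap]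
    exact minpoly.aeval ℚ α
  have hBQ0 : B.map (Int.castRingHom ℚ) ≠ 0 :=
    (Polynomial.map_ne_zero_iff Int.cast_injective).2 hB0
  have hBQ := shiftAct_map_eq_zero (Int.castRingHom ℚ) hB
  obtain ⟨B₁, hB₁, hnd⟩ := exists_eq_pow_rootMultiplicity_mul_and_not_dvd _ hBQ0 1
  set m := (B.map (Int.castRingHom ℚ)).rootMultiplicity 1
  rw [C_1] at hB₁ hnd
  set D := p * B₁
  have hndD : ¬ (X - 1) ∣ D := by
    have hX1 : Prime (X - 1 : ℚ[X]) := by simpa using prime_X_sub_C (1 : ℚ)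
    intro h
    rcases hX1.dvd_or_dvd h with h1 | h1
    · have h2 := hX1.dvd_of_dvd_pow h1
      rw [← C_1, dvd_iff_isRoot] at h2
      exact ne_one_of_one_lt_abs hα (by simpa using (minpoly.root hint h2).symm)
    · exact hnd h1
  set x := expPolySeq α F G
  set uR : ℕ → ℝ := fun k => (u k : ℝ)
  have hbd : SeqBounded (x - uR) := hε
  have hDmap : D.map φ = p.map φ * B₁.map φ := Polynomial.map_mul _
  have hkill : shiftAct ((X - C 1) ^ (m + (G.natDegree + 1))) (shiftAct (D.map φ) (x - uR)) = 0 := by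
    rw [← shiftAct_mul, map_sub, C_1]
    rw [shiftAct_eq_zero_of_dvd (p := (X - C α) ^ (F.natDegree + 1) * (X - 1) ^ (G.natDegree + 1))
      _ (shiftAct_expPolySeq_eq_zero α F G), zero_sub, neg_eq_zero]
    · have h1 := shiftAct_eq_zero_of_dvd (q := (X - 1) ^ (m + (G.natDegree + 1)) * D)
        ⟨(X - 1) ^ (G.natDegree + 1) * p, by rw [hB₁]; ring⟩ hBQ
      have h2 := shiftAct_map_eq_zero φ h1
      simpa using h2
    · obtain ⟨e, he⟩ := hp
      exact ⟨e * B₁.map φ * (X - 1) ^ m, by rw [hDmap, he]; ring⟩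
  have h3 := (hbd.polyShift (D.map φ)).X_sub_C_eq_zero (by simp) hkill
  rw [← shiftAct_mul, map_sub, sub_eq_zero, C_1, mul_comm, shiftAct_expPolySeq,
    shiftAct_eq_zero_of_dvd _ (shiftAct_X_sub_C_pow_eval α F (Nat.lt_succ_self _)), zero_add] at h3
  · refine sub_C_mem_lifts_of_shiftAct_rational hndD
      (r := shiftAct (D * (X - 1)) (fun k => (u k : ℚ))) ?_
    rw [h3]
    have := shiftAct_map φ (D * (X - 1)) (fun k => (u k : ℚ))
    simpa using this
  · rw [hDmap]
    exact hp.trans ⟨B₁.map φ * (X - 1), by ring⟩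

/-- A sequence `F(k) α ^ k + G(k)` satisfying one of the four conditions is not at bounded distance
from a linear recurrent integer sequence. -/
theorem not_bounded_error (hα : IsAlgebraic ℚ α) (hα1 : 1 < |α|) (hF : F ≠ 0)
    (h : (¬ IsPisot |α| ∧ ¬ IsSalem |α|) ∨
      F ∉ lifts (algebraMap (IntermediateField.adjoin ℚ {α}) ℝ) ∨
      G - C (G.eval 0) ∉ lifts (algebraMap ℚ ℝ) ∨
      (IsSalem |α| ∧ 0 < F.natDegree))
    {B : ℤ[X]} (hB0 : B ≠ 0) (hB : shiftAct B u = 0) :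
    ¬ SeqBounded (fun k => expPolySeq α F G k - (u k : ℝ)) := by
  intro hε
  have hint : IsIntegral ℚ α := hα.isIntegral
  have hintZ := isIntegral_of_bounded_error hα1 hF hε hB0 hB
  have hconj : ∀ z : ℂ, IsConjRoot ℚ ((|α| : ℝ) : ℂ) z → z ≠ ((|α| : ℝ) : ℂ) →
      ‖z‖ ≤ 1 ∧ (0 < F.natDegree → ‖z‖ < 1) := by
    have hmin : minpoly ℚ (α : ℂ) = minpoly ℚ α :=
      minpoly.algebraMap_eq (A := ℚ) (B := ℝ) (B' := ℂ) Complex.ofReal_injective α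
    have key : ∀ z : ℂ, IsConjRoot ℚ (α : ℂ) z → z ≠ (α : ℂ) →
        ‖z‖ ≤ 1 ∧ (0 < F.natDegree → ‖z‖ < 1) := fun z hz hne =>
      norm_conj_le_of_bounded_error hα1 hF hε hB0 hB hint (hmin ▸ hz.aeval_eq_zero) hne
    -- For negative `α` the conjugates of `|α|` are the negatives of those of `α`.
    rcases abs_choice α with habs | habs
    · rw [habs]; exact key
    · rw [habs]
      intro z hz hne
      have := key (-z) (by simpa using hz.neg) (fun h0 => hne (by simp [← h0]))
      simpa using this
  have hintabs : IsIntegral ℤ |α| := by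
    rcases abs_choice α with habs | habs <;> rw [habs]
    · exact hintZ
    · exact hintZ.neg
  rcases h with ⟨hP, hS⟩ | h | h | ⟨hS, hf⟩
  · exact hS ⟨hα1, hintabs, fun z hz hne => (hconj z hz hne).1, hP⟩
  · exact h (mem_lifts_of_bounded_error (a := IntermediateField.AdjoinSimple.gen ℚ α)
      (IntermediateField.AdjoinSimple.algebraMap_gen ℚ α) hα1 hε hB0 hB)
  · exact h (sub_C_mem_lifts_of_bounded_error hα1 hint hε hB0 hB)
  · exact hS.2.2.2 ⟨hα1, hintabs, fun z hz hne => (hconj z hz hne).2 hf⟩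

end Approximation

/-! ### Periodicity of sequences with finitely many states -/

section EventuallyPeriodic

lemma eventually_periodic_of_forward {S : Type*} {σ : ℕ → S} (hfin : (Set.range σ).Finite) {K : ℕ}
    (h : ∀ k k', K ≤ k → K ≤ k' → σ k = σ k' → σ (k + 1) = σ (k' + 1)) :
    ∃ p N, 1 ≤ p ∧ K ≤ N ∧ ∀ k, N ≤ k → σ (k + p) = σ k := by
  obtain ⟨a, ha, b, -, hab, heq⟩ := (Set.Ici_infinite K).exists_lt_map_eq_of_mapsTo
    (fun k _ => Set.mem_range_self (f := σ) k) hfin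
  refine ⟨b - a, a, by omega, ha, fun k hk => ?_⟩
  induction k, hk using Nat.le_induction with
  | base => rw [Nat.add_sub_cancel' hab.le, heq]
  | succ k hk ih =>
    have hKa : K ≤ a := ha
    rw [add_right_comm]
    exact h _ _ (by omega) (by omega) ih

/-- Some value recurs infinitely often. Going back from a far occurrence `m` as from `b` to `a`
shows that it also occurs at `m - (b - a)`; going back from these two places to `k` gives the period
from `K` on. -/
lemma eventually_periodic_of_backward {S : Type*} {σ : ℕ → S} (hfin : (Set.range σ).Finite) {K : ℕ}
    (h : ∀ k k', K ≤ k → K ≤ k' → σ (k + 1) = σ (k' + 1) → σ k = σ k') :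
    ∃ p, 1 ≤ p ∧ ∀ k, K ≤ k → σ (k + p) = σ k := by
  have hback : ∀ j k k', K ≤ k → K ≤ k' → σ (k + j) = σ (k' + j) → σ k = σ k' := by
    intro j
    induction j with
    | zero => intro k k' _ _ h; exact h
    | succ j ih =>
      intro k k' hk hk' hj
      exact ih k k' hk hk' (h _ _ (by omega) (by omega) hj)
  have : Finite (Set.range σ) := hfin
  obtain ⟨⟨v, hv⟩, hinf⟩ := Finite.exists_infinite_fiber (Set.rangeFactorization σ)
  have hinf' : {k | σ k = v}.Infinite := by
    rw [← Set.infinite_coe_iff]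
    convert hinf using 2
    ext k
    simp [Set.rangeFactorization, Subtype.ext_iff]
  obtain ⟨a, ha, hKa⟩ := hinf'.exists_gt K
  obtain ⟨b, hb, hab⟩ := hinf'.exists_gt a
  simp only [Set.mem_ofPred_eq] at ha hb
  refine ⟨b - a, by omega, fun k hk => ?_⟩
  obtain ⟨m, hm, hkm⟩ := hinf'.exists_gt (k + b)
  simp only [Set.mem_ofPred_eq] at hm
  have h1 : σ (m - (b - a)) = σ a := by
    refine hback (b - a) _ _ (by omega) (by omega) ?_
    rw [Nat.sub_add_cancel (by omega), Nat.add_sub_cancel' hab.le, hm, hb]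
  refine hback (m - (b - a) - k) _ _ (by omega) hk ?_
  rw [show k + (b - a) + (m - (b - a) - k) = m by omega,
    show k + (m - (b - a) - k) = m - (b - a) by omega, h1, hm, ha]

/-- The residue of the position together with the window of length `n` starting there. -/
def residueWindow (s : ℕ → ℤ) (M n k : ℕ) : ℕ × (Fin n → ℤ) := (k % M, fun i => s (k + i))

lemma residueWindow_range_finite {s : ℕ → ℤ} (hs : (Set.range s).Finite) {M : ℕ} (hM : 1 ≤ M)
    (n : ℕ) : (Set.range (residueWindow s M n)).Finite := by
  refine ((Set.finite_Iio M).prod (Set.Finite.pi' (fun _ : Fin n => hs))).subset ?_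
  rintro _ ⟨k, rfl⟩
  exact ⟨Nat.mod_lt _ hM, fun i => Set.mem_range_self _⟩

lemma residueWindow_eq_iff {s : ℕ → ℤ} {M n k k' : ℕ} :
    residueWindow s M n k = residueWindow s M n k' ↔
      k ≡ k' [MOD M] ∧ ∀ i < n, s (k + i) = s (k' + i) := by
  simp only [residueWindow, Prod.mk.injEq, funext_iff, Fin.forall_iff]
  rfl

/-- Residue and window form a finite-state system in which each state determines the next. -/
lemma eventually_periodic_of_window_right {s : ℕ → ℤ} (hs : (Set.range s).Finite) {M : ℕ}
    (hM : 1 ≤ M) {n K : ℕ}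
    (h : ∀ k k', K ≤ k → K ≤ k' → k ≡ k' [MOD M] → (∀ i < n, s (k + i) = s (k' + i)) →
      s (k + n) = s (k' + n)) :
    ∃ p N, 1 ≤ p ∧ ∀ k, N ≤ k → s (k + p) = s k := by
  obtain ⟨p, N, hp, hKN, hper⟩ := eventually_periodic_of_forward
    (residueWindow_range_finite hs hM n) (K := K) fun k k' hk hk' heq => by
      rw [residueWindow_eq_iff] at heq ⊢
      refine ⟨heq.1.add_right 1, fun i hi => ?_⟩
      rw [add_assoc, add_assoc, add_comm 1 i]
      rcases Nat.lt_or_ge (i + 1) n with h1 | h1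
      · exact heq.2 _ h1
      · obtain rfl : n = i + 1 := by omega
        exact h k k' hk hk' heq.1 heq.2
  refine ⟨p, N + n, hp, fun k hk => ?_⟩
  have h1 := residueWindow_eq_iff.1 (hper (k - n) (by omega))
  have h2 := h _ _ (by omega) (by omega) h1.1 h1.2
  rwa [show k - n + p + n = k + p by omega, Nat.sub_add_cancel (by omega)] at h2

lemma eventually_periodic_of_window_left {s : ℕ → ℤ} (hs : (Set.range s).Finite) {M : ℕ}
    (hM : 1 ≤ M) {n K : ℕ}
    (h : ∀ k k', K ≤ k → K ≤ k' → k ≡ k' [MOD M] → (∀ i < n, s (k + 1 + i) = s (k' + 1 + i)) →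
      s k = s k') :
    ∃ p N, 1 ≤ p ∧ ∀ k, N ≤ k → s (k + p) = s k := by
  have key : ∀ k k', K ≤ k → K ≤ k' → residueWindow s M n (k + 1) = residueWindow s M n (k' + 1) →
      s k = s k' := fun k k' hk hk' heq => by
    rw [residueWindow_eq_iff] at heq
    exact h k k' hk hk' (Nat.ModEq.add_right_cancel' 1 heq.1) heq.2
  obtain ⟨p, hp, hper⟩ := eventually_periodic_of_backward
    (residueWindow_range_finite hs hM n) (K := K) fun k k' hk hk' heq => by
      have h0 := key k k' hk hk' heq
      rw [residueWindow_eq_iff] at heq ⊢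
      refine ⟨Nat.ModEq.add_right_cancel' 1 heq.1, fun i hi => ?_⟩
      rcases i with _ | i
      · exact h0
      · have := heq.2 i (by omega)
        rwa [add_assoc, add_assoc, add_comm 1 i] at this
  refine ⟨p, K, hp, fun k hk => key _ _ (by omega) hk ?_⟩
  rw [add_right_comm]
  exact hper _ (by omega)

end EventuallyPeriodic

/-! ### Means and van der Corput's inequality -/

section Mean

open scoped Topology ComplexConjugate

/-- The averages of a sequence converge to `a`. -/
def HasMean (z : ℕ → ℂ) (a : ℂ) : Prop :=
  Tendsto (fun N : ℕ => (∑ k ∈ Finset.range N, z k) / N) atTop (𝓝 a)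

lemma HasMean.const_mul {z : ℕ → ℂ} {a : ℂ} (h : HasMean z a) (c : ℂ) :
    HasMean (fun k => c * z k) (c * a) := by
  refine (Tendsto.const_mul c h).congr fun N => ?_
  rw [← Finset.mul_sum, mul_div_assoc]

lemma HasMean.sum {ι : Type*} (s : Finset ι) {z : ι → ℕ → ℂ} {a : ι → ℂ}
    (h : ∀ i ∈ s, HasMean (z i) (a i)) : HasMean (fun k => ∑ i ∈ s, z i k) (∑ i ∈ s, a i) := by
  refine (tendsto_finsetSum s h).congr fun N => ?_
  rw [Finset.sum_comm, Finset.sum_div]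

lemma HasMean.conj {z : ℕ → ℂ} {a : ℂ} (h : HasMean z a) :
    HasMean (fun k => conj (z k)) (conj a) := by
  refine ((Complex.continuous_conj.tendsto a).comp h).congr fun N => ?_
  simp

lemma hasMean_const (a : ℂ) : HasMean (fun _ => a) a := by
  refine tendsto_const_nhds.congr' ?_
  filter_upwards [eventually_gt_atTop 0] with N hN
  have : (N : ℂ) ≠ 0 := by exact_mod_cast hN.ne'
  rw [Finset.sum_const, Finset.card_range, nsmul_eq_mul]
  field_simp

lemma hasMean_zero_of_norm_sum_le {z : ℕ → ℂ} {c : ℝ}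
    (h : ∀ N, ‖∑ k ∈ Finset.range N, z k‖ ≤ c) : HasMean z 0 := by
  refine squeeze_zero_norm (fun N => ?_)
    (tendsto_const_nhds.div_atTop tendsto_natCast_atTop_atTop : Tendsto (fun N : ℕ => c / (N : ℝ)) atTop (𝓝 0))
  rw [norm_div, Complex.norm_natCast]
  exact div_le_div_of_nonneg_right (h N) (Nat.cast_nonneg _)

lemma HasMean.add {z w : ℕ → ℂ} {a b : ℂ} (hz : HasMean z a) (hw : HasMean w b) :
    HasMean (fun k => z k + w k) (a + b) := by
  refine (Tendsto.add hz hw).congr fun N => ?_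
  rw [Finset.sum_add_distrib, add_div]

lemma norm_sum_shift_sub_le {z : ℕ → ℂ} {c : ℝ} (hz : ∀ k, ‖z k‖ ≤ c) (h N : ℕ) :
    ‖∑ k ∈ Finset.range N, (z (k + h) - z k)‖ ≤ 2 * c * h := by
  induction h with
  | zero => simp
  | succ h ih =>
    have h1 : ∑ k ∈ Finset.range N, (z (k + (h + 1)) - z k) =
        ∑ k ∈ Finset.range N, (z (k + h) - z k) + (z (N + h) - z (0 + h)) := by
      rw [← Finset.sum_range_sub (fun k => z (k + h)), ← Finset.sum_add_distrib]
      refine Finset.sum_congr rfl fun k _ => ?_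
      rw [show k + (h + 1) = k + 1 + h by ring]; ring
    rw [h1]
    refine (norm_add_le _ _).trans ?_
    have h2 := (norm_sub_le (z (N + h)) (z (0 + h))).trans (add_le_add (hz _) (hz _))
    push_cast
    linarith

lemma HasMean.shift {z : ℕ → ℂ} {a : ℂ} {c : ℝ} (hz : ∀ k, ‖z k‖ ≤ c) (h : HasMean z a) (j : ℕ) :
    HasMean (fun k => z (k + j)) a := by
  have h1 : HasMean (fun k => z (k + j) - z k) 0 :=
    hasMean_zero_of_norm_sum_le fun N => norm_sum_shift_sub_le hz j N
  simpa using h.add h1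

lemma HasMean.le_of_forall_le {x : ℕ → ℝ} {a c : ℝ} (h : HasMean (fun k => (x k : ℂ)) (a : ℂ))
    (hx : ∀ k, x k ≤ c) : a ≤ c := by
  have h1 : Tendsto (fun N : ℕ => (∑ k ∈ Finset.range N, x k) / N) atTop (𝓝 a) := by
    refine ((Complex.continuous_re.tendsto _).comp h).congr fun N => ?_
    simp only [Function.comp]
    rw [← Complex.ofReal_sum, ← Complex.ofReal_natCast, ← Complex.ofReal_div, Complex.ofReal_re]
  refine le_of_tendsto h1 ?_
  filter_upwards [eventually_gt_atTop 0] with N hN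
  have hN' : (0 : ℝ) < N := by exact_mod_cast hN
  rw [div_le_iff₀ hN']
  refine (Finset.sum_le_card_nsmul _ _ c fun k _ => hx k).trans ?_
  rw [Finset.card_range, nsmul_eq_mul, mul_comm]

/-- Van der Corput's criterion. -/
lemma hasMean_zero_of_correlations {z : ℕ → ℂ} (hz : ∀ k, ‖z k‖ = 1)
    (hcor : ∀ h, 1 ≤ h → HasMean (fun k => z (k + h) * conj (z k)) 0) : HasMean z 0 := by
  have hpair : ∀ i j, HasMean (fun k => z (k + i) * conj (z (k + j))) (if i = j then 1 else 0) := by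
    have hlt : ∀ i j, j < i → HasMean (fun k => z (k + i) * conj (z (k + j))) 0 := by
      intro i j hij
      have := (hcor (i - j) (by omega)).shift (c := 1) (fun k => by simp [hz]) j
      refine this.congr fun N => ?_
      congr 1
      refine Finset.sum_congr rfl fun k _ => ?_
      dsimp only
      rw [show k + j + (i - j) = k + i by omega]
    intro i j
    rcases lt_trichotomy i j with hij | rfl | hij
    · rw [if_neg hij.ne]
      have := (hlt j i hij).conj
      simpa [mul_comm] using this
    · rw [if_pos rfl]
      convert hasMean_const 1 using 2 with k
      rw [Complex.mul_conj, Complex.normSq_eq_norm_sq, hz]; simp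
    · rw [if_neg hij.ne']
      exact hlt i j hij
  rw [HasMean, Metric.tendsto_atTop']
  intro ε hε
  -- Sums over windows of length `H = m ^ 2` have mean square `H`, as only diagonal correlations
  -- survive. With `4 * H` as an eventual bound, Cauchy-Schwarz gives `2 * m * N` for their total;
  -- with the edge terms, at most `m * N` for large `N`, the mean of `z` is at most `3 / m < ε`.
  obtain ⟨m, hm⟩ := exists_nat_gt (4 / ε)
  have hm0 : (0 : ℝ) < m := lt_trans (by positivity) hm
  set H := m ^ 2 with hH
  set w : ℕ → ℂ := fun k => ∑ i ∈ Finset.range H, z (k + i) with hw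
  have hsq : HasMean (fun k => ((‖w k‖ ^ 2 : ℝ) : ℂ)) (H : ℂ) := by
    have h1 := HasMean.sum (Finset.range H) fun i (_ : i ∈ Finset.range H) =>
      HasMean.sum (Finset.range H) fun j (_ : j ∈ Finset.range H) => hpair i j
    convert h1 using 2 with k
    · rw [← Complex.normSq_eq_norm_sq, ← Complex.mul_conj, hw, map_sum, Finset.sum_mul_sum]
    · have h2 : ∀ i ∈ Finset.range H, ∑ j ∈ Finset.range H, (if i = j then (1 : ℂ) else 0) = 1 :=
        fun i hi => by rw [Finset.sum_ite_eq, if_pos hi]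
      rw [Finset.sum_congr rfl h2]
      simp
  have hsqR : Tendsto (fun N : ℕ => (∑ k ∈ Finset.range N, ‖w k‖ ^ 2) / N) atTop (𝓝 (H : ℝ)) := by
    refine ((Complex.continuous_re.tendsto _).comp hsq).congr fun N => ?_
    simp only [Function.comp]
    rw [← Complex.ofReal_sum, ← Complex.ofReal_natCast, ← Complex.ofReal_div, Complex.ofReal_re]
  have hHpos : (0 : ℝ) < H := by rw [hH]; push_cast; positivity
  have hev := hsqR.eventually_lt_const (show (H : ℝ) < 4 * H by linarith)
  obtain ⟨N₀, hN₀⟩ := eventually_atTop.1 hev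
  obtain ⟨N₁, hN₁⟩ := exists_nat_gt ((2 * H * H : ℝ) / m)
  refine ⟨max N₀ N₁, fun N hN => ?_⟩
  have hNN₀ : N₀ ≤ N := le_trans (le_max_left _ _) (le_of_lt hN)
  have hNN₁ : N₁ < N := lt_of_le_of_lt (le_max_right _ _) hN
  have hNpos : (0 : ℝ) < N := by exact_mod_cast (Nat.zero_le _).trans_lt hNN₁
  have hA : ‖∑ k ∈ Finset.range N, w k‖ ≤ 2 * m * N := by
    have h1 : (∑ k ∈ Finset.range N, ‖w k‖) ^ 2 ≤ (2 * m * N) ^ 2 := by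
      refine sq_sum_le_card_mul_sum_sq.trans ?_
      rw [Finset.card_range]
      have h2 := hN₀ N hNN₀
      rw [div_lt_iff₀ hNpos, hH] at h2
      push_cast at h2
      nlinarith
    exact (norm_sum_le _ _).trans (abs_le_of_sq_le_sq' h1 (by positivity)).2
  have hB : ‖∑ k ∈ Finset.range N, w k - H * ∑ k ∈ Finset.range N, z k‖ ≤ 2 * H * H := by
    have h1 : ∑ k ∈ Finset.range N, w k - H * ∑ k ∈ Finset.range N, z k =
        ∑ i ∈ Finset.range H, ∑ k ∈ Finset.range N, (z (k + i) - z k) := by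
      simp only [Finset.sum_sub_distrib, hw, Finset.sum_const, Finset.card_range, nsmul_eq_mul]
      rw [Finset.sum_comm]
    rw [h1]
    refine (norm_sum_le_of_le (f := fun i => ∑ k ∈ Finset.range N, (z (k + i) - z k))
      (Finset.range H) (n := fun _ => 2 * (H : ℝ)) fun i hi => ?_).trans ?_
    · refine (norm_sum_shift_sub_le (c := 1) (fun k => (hz k).le) i N).trans ?_
      have : (i : ℝ) ≤ H := by exact_mod_cast (Finset.mem_range.1 hi).le
      linarith
    · rw [Finset.sum_const, Finset.card_range, nsmul_eq_mul]
      exact le_of_eq (by ring)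
  have hC : (H : ℝ) * ‖∑ k ∈ Finset.range N, z k‖ ≤ 2 * m * N + 2 * H * H := by
    have h1 : ‖(H : ℂ) * ∑ k ∈ Finset.range N, z k‖ = H * ‖∑ k ∈ Finset.range N, z k‖ := by
      rw [norm_mul, Complex.norm_natCast]
    rw [← h1]
    have h2 := norm_sub_norm_le ((H : ℂ) * ∑ k ∈ Finset.range N, z k) (∑ k ∈ Finset.range N, w k)
    rw [norm_sub_rev] at h2
    linarith
  have hD : (2 * H * H : ℝ) ≤ m * N := by
    rw [div_lt_iff₀ hm0] at hN₁
    have : (N₁ : ℝ) ≤ N := by exact_mod_cast hNN₁.le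
    nlinarith
  rw [dist_zero_right, norm_div, Complex.norm_natCast, div_lt_iff₀ hNpos]
  rw [div_lt_iff₀ hε] at hm
  have hE : (m : ℝ) * (m * ‖∑ k ∈ Finset.range N, z k‖) ≤ m * (3 * N) := by
    rw [hH] at hC hD
    push_cast at hC hD
    nlinarith
  have hF := le_of_mul_le_mul_left hE hm0
  have hG : (m : ℝ) * ‖∑ k ∈ Finset.range N, z k‖ < m * (ε * N) := by nlinarith
  exact lt_of_mul_lt_mul_left hG hm0.le

/-! ### Weyl's method for polynomial sequences modulo one -/

/-- The additive character `t ↦ exp (2 π i t)`. -/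
noncomputable def unitExp (t : ℝ) : ℂ := Complex.exp (2 * Real.pi * t * Complex.I)

lemma unitExp_add (s t : ℝ) : unitExp (s + t) = unitExp s * unitExp t := by
  rw [unitExp, unitExp, unitExp, ← Complex.exp_add]; push_cast; ring_nf

lemma norm_unitExp (t : ℝ) : ‖unitExp t‖ = 1 := by
  have := Complex.norm_exp_ofReal_mul_I (2 * Real.pi * t)
  push_cast at this
  exact this

lemma unitExp_neg (t : ℝ) : unitExp (-t) = conj (unitExp t) := by
  rw [unitExp, unitExp, ← Complex.exp_conj]; simp [map_ofNat]

lemma unitExp_nat_mul (n : ℕ) (t : ℝ) : unitExp (n * t) = unitExp t ^ n := by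
  rw [unitExp, unitExp, ← Complex.exp_nat_mul]; push_cast; ring_nf

lemma unitExp_intCast (n : ℤ) : unitExp n = 1 := by
  rw [unitExp, Complex.exp_eq_one_iff]; exact ⟨n, by push_cast; ring⟩

lemma unitExp_ne_one {β : ℝ} (hβ : Irrational β) : unitExp β ≠ 1 := by
  rw [unitExp, Ne, Complex.exp_eq_one_iff]
  rintro ⟨n, hn⟩
  have h1 : (β : ℂ) = n := by
    have h2 : (2 * Real.pi * Complex.I : ℂ) ≠ 0 := Complex.two_pi_I_ne_zero
    apply mul_right_cancel₀ h2
    rw [← hn]; ring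
  exact hβ ⟨n, by exact_mod_cast h1.symm⟩

/-- Each van der Corput step replaces `f` by `f (k + h) - f k`, lowering the degree by one and
multiplying `β` by `h ≥ 1`; the base case is a geometric sum. -/
lemma hasMean_unitExp_zero {d : ℕ} : ∀ {f : ℕ → ℝ} {β : ℝ}, Irrational β →
    (∀ k, (fwdDiff 1)^[d + 1] f k = β) → HasMean (fun k => unitExp (f k)) 0 := by
  induction d with
  | zero =>
    intro f β hβ hf
    set q := unitExp β
    have hq : q ≠ 1 := unitExp_ne_one hβ
    have hfk : ∀ k, unitExp (f k) = unitExp (f 0) * q ^ k := by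
      intro k
      induction k with
      | zero => rw [pow_zero, mul_one]
      | succ k ih =>
        have h1 := hf k
        simp only [zero_add, Function.iterate_one, fwdDiff] at h1
        rw [show f (k + 1) = f k + β by linarith, unitExp_add, ih, pow_succ, mul_assoc]
    refine hasMean_zero_of_norm_sum_le (c := 2 / ‖q - 1‖) fun N => ?_
    rw [Finset.sum_congr rfl fun k _ => hfk k, ← Finset.mul_sum, norm_mul, norm_unitExp, one_mul, geom_sum_eq hq, norm_div]
    refine div_le_div_of_nonneg_right ?_ (norm_nonneg _)
    refine (norm_sub_le _ _).trans ?_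
    rw [norm_pow, norm_unitExp]; norm_num
  | succ d ih =>
    intro f β hβ hf
    refine hasMean_zero_of_correlations (fun k => norm_unitExp _) fun h hh => ?_
    have h1 : ∀ k, unitExp (f (k + h)) * conj (unitExp (f k)) = unitExp (f (k + h) - f k) := by
      intro k
      rw [← unitExp_neg, ← unitExp_add, sub_eq_add_neg]
    simp_rw [h1]
    refine ih (β := h * β) (hβ.natCast_mul (by omega)) fun k => ?_
    have h2 : (fwdDiff 1)^[d + 1] (fun k => f (k + h) - f k) k =
        (fwdDiff 1)^[d + 1] f (k + h) - (fwdDiff 1)^[d + 1] f k := by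
      rw [← fwdDiff_iter_comp_add]
      simp [fwdDiff_iter_eq_sum_shift, mul_sub, Finset.sum_sub_distrib]
    rw [h2]
    clear h1 h2 hh
    induction h with
    | zero => simp
    | succ h ihh =>
      have h3 := hf (k + h)
      rw [Function.iterate_succ_apply', fwdDiff] at h3
      rw [← add_assoc]
      push_cast
      linarith

/-- A sequence whose harmonics all average to zero does not stay in an arc of length less than
one. -/
lemma not_eventually_near_of_hasMean {f : ℕ → ℝ}
    (hf : ∀ m : ℕ, 1 ≤ m → HasMean (fun k => unitExp (m * f k)) 0) {θ η : ℝ} (hη : η < 1 / 2)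
    {K : ℕ} (hnear : ∀ k, K ≤ k → ∃ n : ℤ, |f k - θ - n| ≤ η) : False := by
  set z : ℕ → ℂ := fun k => unitExp (f (k + K) - θ) with hz
  have hz1 : ∀ k, ‖z k‖ = 1 := fun k => norm_unitExp _
  have hpow : ∀ m : ℕ, 1 ≤ m → HasMean (fun k => z k ^ m) 0 := by
    intro m hm
    have h1 := ((hf m hm).shift (c := 1) (fun k => (norm_unitExp _).le) K).const_mul
      (unitExp (m * -θ))
    rw [mul_zero] at h1
    convert h1 using 2 with k
    rw [hz, ← unitExp_nat_mul, ← unitExp_add]; ring_nf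
  have hpair : ∀ i j, HasMean (fun k => z k ^ i * conj (z k ^ j)) (if i = j then 1 else 0) := by
    have hzz : ∀ k, z k * conj (z k) = 1 := by
      intro k
      rw [Complex.mul_conj, Complex.normSq_eq_norm_sq, hz1]; simp
    have hsplit : ∀ i j k, z k ^ (i + j) * conj (z k ^ j) = z k ^ i := by
      intro i j k
      rw [map_pow, pow_add, mul_assoc, ← mul_pow, hzz, one_pow, mul_one]
    have hle : ∀ i j, j < i → HasMean (fun k => z k ^ i * conj (z k ^ j)) 0 := by
      intro i j hij
      convert hpow (i - j) (by omega) using 2 with k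
      rw [← hsplit (i - j) j k, Nat.sub_add_cancel hij.le]
    intro i j
    rcases lt_trichotomy i j with hij | rfl | hij
    · rw [if_neg hij.ne]
      simpa [mul_comm] using (hle j i hij).conj
    · rw [if_pos rfl]
      convert hasMean_const 1 using 2 with k
      simpa using hsplit 0 i k
    · rw [if_neg hij.ne']
      exact hle i j hij
  -- The powers of `z` are orthonormal in mean, so expanding `(1 - z) ^ n` leaves a sum of squared
  -- binomials, at least `4 ^ n / (n + 1)`. Staying in the arc bounds the same mean by `r ^ n` with
  -- `r < 4`.
  have hmean : ∀ n : ℕ, HasMean (fun k => (((‖1 - z k‖ ^ 2) ^ n : ℝ) : ℂ))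
      ((∑ i ∈ Finset.range (n + 1), (n.choose i : ℝ) ^ 2 : ℝ) : ℂ) := by
    intro n
    have h1 := HasMean.sum (Finset.range (n + 1)) fun i (_ : i ∈ Finset.range (n + 1)) =>
      HasMean.sum (Finset.range (n + 1)) fun j (_ : j ∈ Finset.range (n + 1)) =>
        (hpair i j).const_mul (((-1) ^ i * n.choose i) * ((-1) ^ j * n.choose j))
    convert h1 using 2 with k
    · have h2 : (1 - z k) ^ n = ∑ i ∈ Finset.range (n + 1), (-1) ^ i * n.choose i * z k ^ i := by
        rw [sub_eq_add_neg, add_comm, add_pow]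
        refine Finset.sum_congr rfl fun i _ => ?_
        rw [neg_pow]; ring
      rw [← Complex.normSq_eq_norm_sq, Complex.ofReal_pow, ← Complex.mul_conj, mul_pow, ← map_pow,
        h2, map_sum, Finset.sum_mul_sum]
      refine Finset.sum_congr rfl fun i _ => Finset.sum_congr rfl fun j _ => ?_
      simp only [map_mul, map_pow, map_neg, map_one, map_natCast]
      ring
    · rw [Complex.ofReal_sum]
      refine Finset.sum_congr rfl fun i hi => ?_
      simp only [mul_ite, mul_one, mul_zero]
      rw [Finset.sum_ite_eq, if_pos hi]
      have h3 : ((-1 : ℂ) ^ i) * (-1) ^ i = 1 := by rw [← mul_pow]; simp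
      push_cast
      linear_combination -(n.choose i : ℂ) ^ 2 * h3
  have hη0 : 0 ≤ η := by
    obtain ⟨n, hn⟩ := hnear K le_rfl
    exact (abs_nonneg _).trans hn
  set r := 2 - 2 * Real.cos (2 * Real.pi * η) with hr
  have hpi := Real.pi_pos
  have hr4 : r < 4 := by
    have := Real.cos_lt_cos_of_nonneg_of_le_pi (x := 2 * Real.pi * η) (y := Real.pi)
      (by positivity) le_rfl (by nlinarith)
    rw [Real.cos_pi] at this
    linarith
  have hr0 : 0 ≤ r := by linarith [Real.cos_le_one (2 * Real.pi * η)]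
  have hbd : ∀ k, ‖1 - z k‖ ^ 2 ≤ r := by
    intro k
    obtain ⟨n, hn⟩ := hnear (k + K) (by omega)
    set t := f (k + K) - θ - n with ht
    have h1 : z k = unitExp t := by
      have h2 : f (k + K) - θ = t + n := by rw [ht]; ring
      change unitExp (f (k + K) - θ) = _
      rw [h2, unitExp_add, unitExp_intCast, mul_one]
    have h2 : unitExp t = ((Real.cos (2 * Real.pi * t) : ℝ) : ℂ) +
        ((Real.sin (2 * Real.pi * t) : ℝ) : ℂ) * Complex.I := by
      rw [unitExp, Complex.exp_mul_I]; push_cast; rfl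
    have h3 : ‖1 - z k‖ ^ 2 = 2 - 2 * Real.cos (2 * Real.pi * t) := by
      rw [h1, h2, ← Complex.normSq_eq_norm_sq, Complex.normSq_apply]
      simp only [Complex.sub_re, Complex.sub_im, Complex.add_re, Complex.add_im, Complex.one_re,
        Complex.one_im, Complex.ofReal_re, Complex.ofReal_im, Complex.mul_re, Complex.mul_im,
        Complex.I_re, Complex.I_im]
      linear_combination Real.sin_sq_add_cos_sq (2 * Real.pi * t)
    have h4 : Real.cos (2 * Real.pi * η) ≤ Real.cos (2 * Real.pi * |t|) :=
      Real.cos_le_cos_of_nonneg_of_le_pi (by positivity) (by nlinarith) (by nlinarith)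
    have h5 : Real.cos (2 * Real.pi * |t|) = Real.cos (2 * Real.pi * t) := by
      rw [← Real.cos_abs (2 * Real.pi * t), abs_mul, abs_of_pos (by positivity : 0 < 2 * Real.pi)]
    linarith
  have hkey : ∀ n : ℕ, (4 : ℝ) ^ n ≤ (n + 1) * r ^ n := by
    intro n
    have h1 := (hmean n).le_of_forall_le (c := r ^ n) fun k =>
      pow_le_pow_left₀ (by positivity) (hbd k) n
    have h2 := sq_sum_le_card_mul_sum_sq (s := Finset.range (n + 1)) (f := fun i => (n.choose i : ℝ))
    have h3 : ∑ i ∈ Finset.range (n + 1), (n.choose i : ℝ) = 2 ^ n := by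
      exact_mod_cast Nat.sum_range_choose n
    rw [h3, Finset.card_range, ← pow_mul, mul_comm n 2, pow_mul] at h2
    norm_num at h2
    exact h2.trans (mul_le_mul_of_nonneg_left h1 (by positivity))
  have hlim : Tendsto (fun n : ℕ => ((n : ℝ) + 1) * (r / 4) ^ n) atTop (𝓝 0) := by
    have habs : |r / 4| < 1 := by rw [abs_of_nonneg (by positivity)]; linarith
    have h1 := tendsto_pow_const_mul_const_pow_of_abs_lt_one 1 habs
    have h2 := tendsto_pow_atTop_nhds_zero_of_abs_lt_one habs
    simpa [add_mul] using h1.add h2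
  obtain ⟨n, hn⟩ := (hlim.eventually_lt_const one_pos).exists
  have h1 := hkey n
  rw [div_pow, ← mul_div_assoc, div_lt_one (by positivity)] at hn
  linarith

lemma fwdDiff_iter_natCast (F : ℝ → ℝ) (n k : ℕ) :
    (fwdDiff 1)^[n] (fun k : ℕ => F k) k = (fwdDiff (1 : ℝ))^[n] F k := by
  simp [fwdDiff_iter_eq_sum_shift]

/-- Polynomial sequences with an irrational nonconstant coefficient do not stay modulo one in an arc
of length less than one. -/
lemma not_eventually_near_of_not_mem_lifts {H : ℝ[X]}
    (hH : H - C (H.eval 0) ∉ lifts (algebraMap ℚ ℝ)) {θ η : ℝ} (hη : η < 1 / 2)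
    {K : ℕ} (hnear : ∀ k, K ≤ k → ∃ n : ℤ, |H.eval (k : ℝ) - θ - n| ≤ η) : False := by
  classical
  set s := H.support.filter fun i => 1 ≤ i ∧ Irrational (H.coeff i) with hs
  have hsmem : ∀ i, i ∈ s ↔ 1 ≤ i ∧ Irrational (H.coeff i) := by
    intro i
    rw [hs, Finset.mem_filter, mem_support_iff, and_iff_right_iff_imp]
    exact fun h => h.2.ne_zero
  have hsne : s.Nonempty := by
    rw [lifts_iff_coeff_lifts, not_forall] at hH
    obtain ⟨i, hi⟩ := hH
    rcases i with _ | i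
    · exact absurd ⟨0, by simp [coeff_zero_eq_eval_zero]⟩ hi
    · rw [coeff_sub, coeff_C_succ, sub_zero] at hi
      exact ⟨i + 1, (hsmem _).2 ⟨by omega, hi⟩⟩
  set j := s.max' hsne with hj
  have hjs := (hsmem j).1 (s.max'_mem hsne)
  have hrat : ∀ i, ∃ r : ℚ, j < i → H.coeff i = r := by
    intro i
    by_cases hi : j < i
    · by_contra! hcon
      have : i ∈ s := (hsmem i).2 ⟨by omega, fun ⟨r, hr⟩ => (hcon r).2 hr.symm⟩
      exact absurd (s.le_max' i this) (by omega)
    · exact ⟨0, fun h => absurd h hi⟩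
  choose r hr using hrat
  set D := H.natDegree
  -- Along multiples of `q` the terms above the last irrational one are integers, leaving a
  -- polynomial with irrational leading coefficient. For `i ≤ j` the value `r i` is arbitrary and
  -- only contributes a nonzero factor.
  set q : ℕ := ∏ i ∈ Finset.range (j + 1 + D), (r i).den with hq
  have hq0 : q ≠ 0 := Finset.prod_ne_zero_iff.2 fun i _ => (r i).den_nz
  have hint : ∀ i, j < i → i < j + 1 + D → ∀ k : ℕ, ∃ m : ℤ, H.coeff i * ((q * k : ℕ) : ℝ) ^ i = m := by
    intro i hi hiD k
    obtain ⟨c, hc⟩ : (r i).den ∣ q := Finset.dvd_prod_of_mem _ (Finset.mem_range.2 hiD)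
    obtain ⟨i', rfl⟩ : ∃ i', i = i' + 1 := ⟨i - 1, by omega⟩
    refine ⟨(r (i' + 1)).num * c * k * (q * k) ^ i', ?_⟩
    have h1 : (r (i' + 1) : ℝ) * (r (i' + 1)).den = (r (i' + 1)).num := by
      exact_mod_cast Rat.mul_den_eq_num (r (i' + 1))
    rw [hr _ hi, pow_succ]
    push_cast
    rw [← h1]
    have h2 : (q : ℝ) = (r (i' + 1)).den * c := by exact_mod_cast hc
    linear_combination ((r (i' + 1)) : ℝ) * ((q : ℝ) * k) ^ i' * k * h2
  set A : ℝ[X] := ∑ i ∈ Finset.range (j + 1), C (H.coeff i * (q : ℝ) ^ i) * X ^ i with hA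
  have hAcoeff : ∀ i, A.coeff i = if i < j + 1 then H.coeff i * (q : ℝ) ^ i else 0 := by
    intro i
    rw [hA, finsetSum_coeff]
    simp only [coeff_C_mul_X_pow, Finset.sum_ite_eq, Finset.mem_range]
  have hAj : Irrational (A.coeff j) := by
    rw [hAcoeff, if_pos (by omega)]
    exact_mod_cast hjs.2.mul_natCast (pow_ne_zero j hq0)
  have hAdeg : A.natDegree = j := by
    refine natDegree_eq_of_le_of_coeff_ne_zero ?_ hAj.ne_zero
    rw [natDegree_le_iff_coeff_eq_zero]
    intro i hi
    rw [hAcoeff, if_neg (by omega)]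
  have hHA : ∀ k : ℕ, ∃ m : ℤ, H.eval ((q * k : ℕ) : ℝ) = A.eval (k : ℝ) + m := by
    intro k
    choose! m hm using fun i hi hiD => hint i hi hiD k
    refine ⟨∑ x ∈ Finset.range D, m (j + 1 + x), ?_⟩
    rw [eval_eq_sum_range' (show H.natDegree < j + 1 + D by omega), Finset.sum_range_add, hA,
      eval_finsetSum]
    congr 1
    · refine Finset.sum_congr rfl fun i _ => ?_
      simp only [eval_mul, eval_C, eval_pow, eval_X]
      push_cast
      ring
    · push_cast
      refine Finset.sum_congr rfl fun x hx => ?_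
      rw [Finset.mem_range] at hx
      rw [← hm _ (by omega) (by omega)]
      push_cast
      ring
  refine not_eventually_near_of_hasMean (f := fun k : ℕ => A.eval (k : ℝ)) (θ := θ) (K := K)
    (fun m hm => ?_) hη fun k hk => ?_
  · obtain ⟨d, hd⟩ : ∃ d, j = d + 1 := ⟨j - 1, by omega⟩
    refine hasMean_unitExp_zero (d := d) (β := m * (A.coeff j * (j.factorial : ℕ)))
      ((hAj.mul_natCast (Nat.factorial_ne_zero j)).natCast_mul (by omega)) fun k => ?_
    have h1 := fwdDiff_iter_const_smul (h := 1) (m : ℝ) (fun k : ℕ => A.eval (k : ℝ)) (d + 1)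
    have h2 := congrFun h1 k
    have h3 := congrFun (Polynomial.fwdDiff_iter_degree_eq_factorial A) (k : ℝ)
    rw [hAdeg, leadingCoeff, hAdeg] at h3
    change (fwdDiff 1)^[d + 1] (fun k : ℕ => (m : ℝ) * A.eval (k : ℝ)) k =
      m * (fwdDiff 1)^[d + 1] (fun k : ℕ => A.eval (k : ℝ)) k at h2
    rw [h2, fwdDiff_iter_natCast (fun t => A.eval t), ← hd]
    change (fwdDiff 1)^[j] (fun t => A.eval t) (k : ℝ) = _ at h3
    rw [h3]
    simp
  · obtain ⟨m, hm⟩ := hHA k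
    obtain ⟨n, hn⟩ := hnear (q * k) (hk.trans (Nat.le_mul_of_pos_left k (Nat.pos_of_ne_zero hq0)))
    refine ⟨n - m, ?_⟩
    rw [hm] at hn
    push_cast
    convert hn using 2
    ring

end Mean

/-! ### From limit values in short arcs to nearby integers -/

section LimitValues

open scoped Topology

/-- If the limit values lie in an arc, then the sequence eventually stays near this arc. -/
lemma eventually_near_of_limitValues_subset {x : ℕ → ℝ} {a b δ : ℝ} (hδ : 0 < δ)
    (h : limitValues x ⊆ (fun t : ℝ => (t : UnitAddCircle)) '' Set.Icc a b) :
    ∀ᶠ k in atTop, ∃ n : ℤ, x k - n ∈ Set.Ioo (a - δ) (b + δ) := by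
  set U : Set UnitAddCircle := (fun t : ℝ => (t : UnitAddCircle)) '' Set.Ioo (a - δ) (b + δ)
  have hU : IsOpen U := QuotientAddGroup.isOpenMap_coe _ isOpen_Ioo
  have hev : ∀ᶠ k in atTop, (x k : UnitAddCircle) ∈ U := by
    by_contra hcon
    obtain ⟨y, hy, hcl⟩ := hU.isClosed_compl.isCompact.exists_mapClusterPt_of_frequently
      (f := fun k => (x k : UnitAddCircle)) (not_eventually.1 hcon)
    obtain ⟨t, ht, rfl⟩ := h hcl
    exact hy ⟨t, ⟨by linarith [ht.1], by linarith [ht.2]⟩, rfl⟩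
  filter_upwards [hev] with k hk
  obtain ⟨t, ht, htx⟩ := hk
  have h1 : ((x k - t : ℝ) : UnitAddCircle) = 0 := by
    rw [AddCircle.coe_sub, sub_eq_zero]; exact htx.symm
  obtain ⟨n, hn⟩ := AddCircle.coe_eq_zero_iff (1 : ℝ) |>.1 h1
  rw [zsmul_one] at hn
  refine ⟨n, ?_⟩
  rwa [hn, sub_sub_cancel]

lemma polyLength_pos {R : ℝ[X]} (hR : R ≠ 0) : 0 < polyLength R :=
  Finset.sum_pos (fun _ hi => abs_pos.2 (mem_support_iff.1 hi)) (support_nonempty.2 hR)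

lemma abs_shiftAct_le (R : ℝ[X]) {e : ℕ → ℝ} {k : ℕ} {c : ℝ} (he : ∀ i, |e (k + i)| ≤ c) :
    |shiftAct R e k| ≤ polyLength R * c := by
  rw [shiftAct_apply, polyLength, Finset.sum_mul]
  refine (Finset.abs_sum_le_sum_abs _ _).trans (Finset.sum_le_sum fun i _ => ?_)
  rw [abs_mul]
  exact mul_le_mul_of_nonneg_left (he i) (abs_nonneg _)

lemma abs_shiftAct_sub_shiftAct_le (R : ℝ[X]) {e : ℕ → ℝ} {k k' : ℕ} {c : ℝ}
    (he : ∀ i, |e (k + i) - e (k' + i)| ≤ c) :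
    |shiftAct R e k - shiftAct R e k'| ≤ polyLength R * c := by
  have h1 := abs_shiftAct_le R (e := fun i => e (k + i) - e (k' + i)) (k := 0) (c := c)
    (by simpa using he)
  rw [shiftAct_apply] at h1 ⊢
  rw [shiftAct_apply, ← Finset.sum_sub_distrib]
  simpa [mul_sub] using h1

lemma shiftAct_intCast (S : ℤ[X]) (u : ℕ → ℤ) (k : ℕ) :
    shiftAct (S.map (Int.castRingHom ℝ)) (fun k => (u k : ℝ)) k = (shiftAct S u k : ℝ) :=
  congrFun (shiftAct_map (Int.castRingHom ℝ) S u) k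

lemma shiftAct_const (R : ℝ[X]) (c : ℝ) (k : ℕ) :
    shiftAct R (fun _ => c) k = shiftAct R (fun _ => c) 0 := by
  simp [shiftAct_apply]

lemma exists_multiplier_of_lt_one_div_reducedLength {R : ℝ[X]} {c : ℝ} (hc : 0 < c)
    (h : c < 1 / reducedLength R) :
    ∃ Q : ℝ[X], (Q.leadingCoeff = 1 ∨ Q.coeff 0 = 1) ∧ polyLength (R * Q) * c < 1 := by
  -- As `1 / 0 = 0`, a positive `c` below the quotient forces the reduced length to be positive.
  have hpos : 0 < reducedLength R := one_div_pos.1 (hc.trans h)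
  rw [lt_one_div hc hpos] at h
  have hne : {t : ℝ | ∃ Q : ℝ[X], (Q.leadingCoeff = 1 ∨ Q.coeff 0 = 1) ∧
      t = polyLength (R * Q)}.Nonempty := ⟨_, 1, Or.inl leadingCoeff_one, rfl⟩
  obtain ⟨_, ⟨Q, hQ, rfl⟩, hlt⟩ := exists_lt_of_csInf_lt hne h
  exact ⟨Q, hQ, (lt_div_iff₀ hc).1 hlt⟩

/-- If an integer operator maps `x` to a constant sequence, and the limit values of `x` along the
residue classes modulo `M` lie in short arcs, then that operator maps the sequence of suitable
nearby integers to an eventually periodic sequence. -/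
lemma exists_nearby_eventually_periodic {x : ℕ → ℝ} {S : ℤ[X]} {c₀ : ℝ}
    (hS : ∀ k, shiftAct (S.map (Int.castRingHom ℝ)) x k = c₀) {M : ℕ} (hM : 1 ≤ M)
    (hI : ∀ l, InIntervalOfLengthLT (limitValues fun k => x (k * M + l))
      (1 / reducedLength (S.map (Int.castRingHom ℝ)))) :
    ∃ u : ℕ → ℤ, SeqBounded (fun k => x k - (u k : ℝ)) ∧
      ∃ p N, 1 ≤ p ∧ ∀ k, N ≤ k → shiftAct S u (k + p) = shiftAct S u k := by
  set SR := S.map (Int.castRingHom ℝ) with hSR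
  choose a b hab hlt hsub using hI
  -- The longest of the `M` arcs yields a single `c`, hence a single multiplier `Q`, for all residue
  -- classes.
  obtain ⟨l₀, -, hl₀⟩ := Finset.exists_max_image (Finset.range M) (fun l => b l - a l)
    ⟨0, Finset.mem_range.2 hM⟩
  obtain ⟨c, hc1, hc2⟩ := exists_between (hlt l₀)
  have hc0 : 0 < c := (sub_nonneg.2 (hab l₀)).trans_lt hc1
  obtain ⟨Q, hQ, hQc⟩ := exists_multiplier_of_lt_one_div_reducedLength hc0 hc2
  set δ := (c - (b l₀ - a l₀)) / 2 with hδdef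
  have hδ : 0 < δ := by rw [hδdef]; linarith
  have hwidth : ∀ l < M, b l - a l + 2 * δ ≤ c := fun l hl => by
    have := hl₀ l (Finset.mem_range.2 hl)
    rw [hδdef]; linarith
  have hev : ∀ᶠ k in atTop, ∀ l ∈ Finset.range M, ∃ n : ℤ,
      x (k * M + l) - n ∈ Set.Ioo (a l - δ) (b l + δ) :=
    (eventually_all_finset _).2 fun l _ => eventually_near_of_limitValues_subset hδ (hsub l)
  obtain ⟨K₀, hK₀⟩ := eventually_atTop.1 hev
  have hnear : ∀ k, ∃ n : ℤ, (K₀ * M ≤ k → x k - n ∈ Set.Ioo (a (k % M) - δ) (b (k % M) + δ)) ∧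
      (k < K₀ * M → |x k - n| ≤ 1 / 2) := by
    intro k
    rcases Nat.lt_or_ge k (K₀ * M) with hk | hk
    · exact ⟨round (x k), fun h => absurd h (by omega), fun _ => abs_sub_round _⟩
    · obtain ⟨n, hn⟩ := hK₀ (k / M) ((Nat.le_div_iff_mul_le hM).2 hk) (k % M)
        (Finset.mem_range.2 (Nat.mod_lt _ hM))
      rw [Nat.div_add_mod'] at hn
      exact ⟨n, fun _ => hn, fun h => absurd h (by omega)⟩
  choose u hu hu' using hnear
  have hbd : SeqBounded (fun k => x k - (u k : ℝ)) := by
    refine ⟨1 / 2 + (∑ l ∈ Finset.range M, (|a l| + |b l|) + δ), fun k => ?_⟩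
    have hnn : 0 ≤ ∑ l ∈ Finset.range M, (|a l| + |b l|) :=
      Finset.sum_nonneg fun l _ => by positivity
    rw [Real.norm_eq_abs]
    rcases Nat.lt_or_ge k (K₀ * M) with hk | hk
    · linarith [hu' k hk]
    · have h1 := hu k hk
      have h2 := Finset.single_le_sum (f := fun l => |a l| + |b l|)
        (fun l _ => by positivity) (Finset.mem_range.2 (Nat.mod_lt k hM))
      have h3 := abs_le.1 (le_refl |a (k % M)|)
      have h4 := abs_le.1 (le_refl |b (k % M)|)
      have h5 := abs_nonneg (a (k % M))
      have h6 := abs_nonneg (b (k % M))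
      rw [abs_le]
      constructor <;> linarith [h1.1, h1.2]
  refine ⟨u, hbd, ?_⟩
  set e : ℕ → ℝ := fun k => x k - (u k : ℝ) with he
  set s := shiftAct S u with hs
  -- The integers `s k` are a constant minus a bounded error, so they take finitely many values.
  have hse : (fun k => (s k : ℝ)) = (fun _ => c₀) - shiftAct SR e := by
    ext k
    rw [hs, ← shiftAct_intCast, ← hSR, Pi.sub_apply, ← hS k, he]
    change _ = _ - shiftAct SR (x - fun k => (u k : ℝ)) k
    rw [map_sub, Pi.sub_apply]; ring
  have hfin : (Set.range s).Finite := by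
    obtain ⟨C, hC⟩ := hbd.polyShift SR
    refine (Set.finite_Icc (-⌈|c₀| + C⌉) ⌈|c₀| + C⌉).subset ?_
    rintro _ ⟨k, rfl⟩
    have h1 : |(s k : ℝ)| ≤ |c₀| + C := by
      rw [show (s k : ℝ) = c₀ - shiftAct SR e k from congrFun hse k]
      exact (abs_sub _ _).trans (add_le_add_right (hC k) _)
    rw [Set.mem_Icc, ← abs_le]
    have h2 := h1.trans (Int.le_ceil _)
    exact_mod_cast h2
  -- At congruent positions the errors lie in the same arc of width at most `c`, and the constant
  -- `c₀` cancels.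
  have hclose : ∀ k k', K₀ * M ≤ k → K₀ * M ≤ k' → k ≡ k' [MOD M] →
      |shiftAct Q (fun k => (s k : ℝ)) k - shiftAct Q (fun k => (s k : ℝ)) k'| < 1 := by
    intro k k' hk hk' hkk
    rw [hse, map_sub, Pi.sub_apply, Pi.sub_apply, shiftAct_const Q c₀ k, shiftAct_const Q c₀ k',
      sub_sub_sub_cancel_left, ← shiftAct_mul, mul_comm Q SR, abs_sub_comm]
    refine (abs_shiftAct_sub_shiftAct_le _ fun i => ?_).trans_lt hQc
    have h1 := hu (k + i) (by omega)
    have h2 := hu (k' + i) (by omega)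
    rw [← (hkk.add_right i : (k + i) % M = (k' + i) % M)] at h2
    have h3 := hwidth _ (Nat.mod_lt (k + i) hM)
    simp only [he]
    rw [abs_le]
    constructor <;> linarith [h1.1, h1.2, h2.1, h2.2]
  have hint : ∀ m n : ℤ, |(m : ℝ) - n| < 1 → m = n := by
    intro m n hmn
    rw [← Int.cast_sub, ← Int.cast_abs] at hmn
    have h1 : |m - n| < 1 := by exact_mod_cast hmn
    have := Int.abs_lt_one_iff.1 h1
    omega
  have hQs := fun k => shiftAct_apply_of_natDegree_lt (Nat.lt_succ_self Q.natDegree)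
    (fun k => (s k : ℝ)) k
  -- Equal windows cancel all terms but the one with coefficient `1`, leaving a difference of
  -- integers below one in modulus: the window determines the next value, or the previous one.
  rcases hQ with hQ | hQ
  · refine eventually_periodic_of_window_right hfin hM (n := Q.natDegree) (K := K₀ * M)
      fun k k' hk hk' hkk hwin => hint _ _ ?_
    convert hclose k k' hk hk' hkk using 2
    rw [hQs, hQs, Finset.sum_range_succ, Finset.sum_range_succ, coeff_natDegree, hQ,
      Finset.sum_congr rfl fun i hi => by rw [hwin i (Finset.mem_range.1 hi)]]
    ring
  · refine eventually_periodic_of_window_left hfin hM (n := Q.natDegree) (K := K₀ * M)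
      fun k k' hk hk' hkk hwin => hint _ _ ?_
    convert hclose k k' hk hk' hkk using 2
    have hcongr : ∀ i ∈ Finset.range Q.natDegree, Q.coeff (i + 1) * (s (k + (i + 1)) : ℝ) =
        Q.coeff (i + 1) * (s (k' + (i + 1)) : ℝ) := fun i hi => by
      have := hwin i (Finset.mem_range.1 hi)
      rw [add_assoc, add_assoc, add_comm 1 i] at this
      rw [this]
    rw [hQs, hQs, Finset.sum_range_succ', Finset.sum_range_succ', hQ, Finset.sum_congr rfl hcongr]
    simp

/-- The polynomial whose values are obtained by applying a shift operator to those of `G`. -/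
noncomputable def shiftPoly (R G : ℝ[X]) : ℝ[X] :=
  ∑ i ∈ R.support, C (R.coeff i) * G.comp (X + C (i : ℝ))

lemma eval_shiftPoly (R G : ℝ[X]) (k : ℕ) :
    (shiftPoly R G).eval (k : ℝ) = shiftAct R (fun k : ℕ => G.eval (k : ℝ)) k := by
  simp [shiftPoly, eval_finsetSum, shiftAct_apply]

/-- If an integer operator with nonzero coefficient sum maps `x` to the same sequence as it does
`G`, where `G` has an irrational nonconstant coefficient, then the limit values of `x` do not lie in
an arc short in comparison with the length of the operator. -/
lemma not_limitValues_subset_of_shiftAct_eq {x : ℕ → ℝ} {G : ℝ[X]}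
    (hG : G - C (G.eval 0) ∉ lifts (algebraMap ℚ ℝ)) {R : ℤ[X]} (hR : R.eval 1 ≠ 0)
    (hx : shiftAct (R.map (Int.castRingHom ℝ)) x =
      shiftAct (R.map (Int.castRingHom ℝ)) (fun k : ℕ => G.eval (k : ℝ)))
    {a b c : ℝ} (hc : b - a < c) (hRc : intPolyLength R * c < 1) :
    ¬ limitValues x ⊆ (fun t : ℝ => (t : UnitAddCircle)) '' Set.Icc a b := by
  intro hsub
  set RR := R.map (Int.castRingHom ℝ) with hRR
  set δ := (c - (b - a)) / 2 with hδ
  obtain ⟨K, hK⟩ := eventually_atTop.1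
    (eventually_near_of_limitValues_subset (show 0 < δ by rw [hδ]; linarith) hsub)
  choose! u hu using hK
  -- The errors lie within `c / 2` of the midpoint `(a + b) / 2`; `θ` is the image of this constant,
  -- and the length of `R` scales the radius.
  refine not_eventually_near_of_not_mem_lifts (H := shiftPoly RR G)
    (θ := shiftAct RR (fun _ => (a + b) / 2) 0) (η := intPolyLength R * (c / 2)) (K := K) ?_
    (by linarith) fun k hk => ⟨shiftAct R u k, ?_⟩
  · intro hlift
    have hrat : ∀ k : ℕ, ∃ q : ℚ,
        (shiftPoly RR G).eval (k : ℝ) - (shiftPoly RR G).eval 0 = q := by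
      intro k
      obtain ⟨H, hH⟩ := hlift
      refine ⟨H.eval (k : ℚ), ?_⟩
      have h1 := congrArg (fun p => p.eval (k : ℝ)) hH
      change (H.map (algebraMap ℚ ℝ)).eval (k : ℝ) = _ at h1
      rw [eval_natCast_map] at h1
      simpa using h1.symm
    choose q hq using hrat
    refine hG (sub_C_mem_lifts_of_shiftAct_rational (D := R.map (Int.castRingHom ℚ))
      (r := fun k => q (k + 1) - q k) ?_ ?_)
    · rw [← C_1, dvd_iff_isRoot, IsRoot, eval_one_map]
      simpa using hR
    · have hmap : (R.map (Int.castRingHom ℚ)).map (algebraMap ℚ ℝ) = RR := by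
        rw [Polynomial.map_map]; congr 1
      rw [hmap, mul_comm, shiftAct_mul]
      ext k
      rw [← C_1, shiftAct_X_sub_C, ← eval_shiftPoly, ← eval_shiftPoly]
      push_cast [← hq]
      ring
  · rw [eval_shiftPoly, ← hx, ← shiftAct_intCast, ← hRR, ← shiftAct_const RR _ k,
      ← Pi.sub_apply, ← Pi.sub_apply, ← map_sub, ← map_sub]
    refine abs_shiftAct_le RR fun i => ?_
    have h1 := hu (k + i) (by omega)
    simp only [Pi.sub_apply]
    rw [abs_le]
    constructor <;> linarith [h1.1, h1.2]

end LimitValues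

/-! ### The integer minimal polynomial and degrees -/

section MinimalPolynomial

lemma IsIntMinpoly.X_sub_C_pow_dvd {P : ℤ[X]} {α : ℝ} (hP : IsIntMinpoly P α) (n : ℕ) :
    (X - C α) ^ n ∣ (P ^ n).map (Int.castRingHom ℝ) := by
  rw [Polynomial.map_pow]
  refine pow_dvd_pow_of_dvd ?_ _
  rw [dvd_iff_isRoot, IsRoot, eval_map]
  exact hP.2

/-- Otherwise the irreducible `P` would be associated to `X - 1`, forcing `α = 1`. -/
lemma IsIntMinpoly.eval_one_ne_zero {P : ℤ[X]} {α : ℝ} (hP : IsIntMinpoly P α) (hα : 1 < |α|) :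
    P.eval 1 ≠ 0 := by
  intro h0
  obtain ⟨q, hq⟩ := dvd_iff_isRoot.2 h0
  have hunit := (hP.1.isUnit_or_isUnit hq).resolve_left (not_isUnit_X_sub_C 1)
  have h1 := hP.2
  rw [hq, map_mul, mul_eq_zero] at h1
  rcases h1 with h1 | h1
  · simp [sub_eq_zero] at h1
    exact ne_one_of_one_lt_abs hα h1
  · exact (hunit.map (aeval α)).ne_zero h1

lemma natDegree_eq_of_polyDeg_eq {F : ℝ[X]} {f : ℕ} (h : polyDeg F = (f : ℤ)) :
    F ≠ 0 ∧ F.natDegree = f := by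
  by_cases h0 : F = 0
  · rw [polyDeg, if_pos h0] at h
    omega
  · rw [polyDeg, if_neg h0] at h
    exact ⟨h0, by exact_mod_cast h⟩

/-- The factor `X ^ N` discards the initial terms, turning an eventual recurrence into a full one.
-/
lemma shiftAct_eq_zero_of_forall_eq_zero {R : Type*} [CommRing R] {D : R[X]} {u : ℕ → R} {N : ℕ}
    (h : ∀ k, N ≤ k → shiftAct D u k = 0) : shiftAct (X ^ N * D) u = 0 := by
  rw [shiftAct_mul]
  ext k
  rw [shiftAct_X_pow, h _ (Nat.le_add_left _ _), Pi.zero_apply]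

end MinimalPolynomial

/-! ### The three conclusions -/

theorem corollary1p7 (α : ℝ) (hα : IsAlgebraic ℚ α) (hα1 : 1 < |α|)
    (P : ℤ[X]) (hP : IsIntMinpoly P α)
    (F G : ℝ[X]) (f : ℕ) (g : ℤ) (hf : polyDeg F = (f : ℤ)) (hg : polyDeg G = g)
    (h : (¬ IsPisot |α| ∧ ¬ IsSalem |α|) ∨
      F ∉ lifts (algebraMap (IntermediateField.adjoin ℚ {α}) ℝ) ∨
      G - C (G.eval 0) ∉ lifts (algebraMap ℚ ℝ) ∨
      (IsSalem |α| ∧ 0 < f)) :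
    (∀ Q : ℤ[X], Q ≠ 0 →
      1 / intPolyLength ((X - 1) ^ (g + 1).toNat * P ^ (f + 1) * Q) ≤
        limsup (fun k : ℕ => distNearestInt (expPolySeq α F G k)) atTop) ∧
    (∀ M : ℕ, 1 ≤ M → ∃ l : ℕ,
      ¬ InIntervalOfLengthLT (limitValues fun k => expPolySeq α F G (k * M + l))
        (1 / intReducedLength ((X - 1) ^ (max g 0).toNat * P ^ (f + 1)))) ∧
    (G - C (G.eval 0) ∉ lifts (algebraMap ℚ ℝ) →
      ¬ InIntervalOfLengthLT (limitValues (expPolySeq α F G))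
        (1 / sInf {t : ℝ | ∃ Q : ℤ[X], Q.eval 1 ≠ 0 ∧ t = intPolyLength (P ^ (f + 1) * Q)})) := by
  obtain ⟨hF, rfl⟩ := natDegree_eq_of_polyDeg_eq hf
  have hP0 : P ≠ 0 := hP.1.ne_zero
  have hX1 : (X - 1 : ℤ[X]) ≠ 0 := by simpa using X_sub_C_ne_zero (1 : ℤ)
  have hbounded := fun (u : ℕ → ℤ) (B : ℤ[X]) (hB0 : B ≠ 0) (hB : shiftAct B u = 0) =>
    not_bounded_error (G := G) hα hα1 hF h hB0 hB
  have hFkill : ∀ D : ℤ[X], P ^ (F.natDegree + 1) ∣ D →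
      shiftAct (D.map (Int.castRingHom ℝ)) (fun k : ℕ => F.eval (k : ℝ) * α ^ k) = 0 :=
    fun D hD => shiftAct_eq_zero_of_dvd
      ((hP.X_sub_C_pow_dvd _).trans (Polynomial.map_dvd _ hD))
      (shiftAct_X_sub_C_pow_eval α F (Nat.lt_succ_self _))
  have hGkill : ∀ D : ℤ[X], (X - 1) ^ (G.natDegree + 1) ∣ D →
      shiftAct (D.map (Int.castRingHom ℝ)) (fun k : ℕ => G.eval (k : ℝ)) = 0 :=
    fun D hD => shiftAct_eq_zero_of_dvd (by simpa using Polynomial.map_dvd (Int.castRingHom ℝ) hD)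
      (shiftAct_X_sub_one_pow_eval G (Nat.lt_succ_self _))
  refine ⟨fun Q hQ => ?_, fun M hM => ?_, fun hG => ?_⟩
  · set R := (X - 1) ^ (g + 1).toNat * P ^ (F.natDegree + 1) * Q with hR
    have hR0 : R ≠ 0 := mul_ne_zero (mul_ne_zero (pow_ne_zero _ hX1) (pow_ne_zero _ hP0)) hQ
    have hLpos : 0 < intPolyLength R :=
      polyLength_pos ((Polynomial.map_ne_zero_iff Int.cast_injective).2 hR0)
    have hRx : shiftAct (R.map (Int.castRingHom ℝ)) (expPolySeq α F G) = 0 := by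
      rw [shiftAct_expPolySeq, hFkill R ⟨(X - 1) ^ (g + 1).toNat * Q, by rw [hR]; ring⟩, zero_add]
      -- For `G = 0` the exponent `g + 1` is zero, one less than `G.natDegree + 1`, but there is
      -- nothing to kill.
      by_cases hG0 : G = 0
      · subst hG0
        simp only [eval_zero]
        exact map_zero _
      · have hgn : (g + 1).toNat = G.natDegree + 1 := by
          rw [polyDeg, if_neg hG0] at hg
          omega
        refine hGkill R ?_
        rw [hR, hgn, mul_assoc]
        exact Dvd.intro _ rfl
    by_contra! hlt
    obtain ⟨c, hc1, hc2⟩ := exists_between hlt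
    have hev := eventually_lt_of_limsup_lt hc1
      (isBoundedUnder_of ⟨1 / 2, fun k => abs_sub_round _⟩)
    obtain ⟨N, hN⟩ := eventually_atTop.1 hev
    set u : ℕ → ℤ := fun k => round (expPolySeq α F G k)
    refine hbounded u (X ^ N * R) (mul_ne_zero (pow_ne_zero _ X_ne_zero) hR0)
      (shiftAct_eq_zero_of_forall_eq_zero fun k hk => ?_) ⟨1 / 2, fun k => abs_sub_round _⟩
    have h1 := abs_shiftAct_le (R.map (Int.castRingHom ℝ))
      (e := expPolySeq α F G - fun k => (u k : ℝ)) (k := k) (c := c)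
      fun i => (hN (k + i) (by omega)).le
    rw [map_sub, hRx, zero_sub, Pi.neg_apply, abs_neg, shiftAct_intCast] at h1
    have h2 : |(shiftAct R u k : ℝ)| < 1 :=
      h1.trans_lt (by rwa [lt_div_iff₀ hLpos, mul_comm] at hc2)
    exact Int.abs_lt_one_iff.1 (by exact_mod_cast h2)
  · by_contra! hI
    have hgn : (max g 0).toNat = G.natDegree := by
      rw [polyDeg] at hg
      split_ifs at hg with h0
      · subst hg; simp [h0]
      · omega
    rw [hgn] at hI
    set S := (X - 1) ^ G.natDegree * P ^ (F.natDegree + 1) with hS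
    have hS0 : S ≠ 0 := mul_ne_zero (pow_ne_zero _ hX1) (pow_ne_zero _ hP0)
    -- `S` has one factor `X - 1` too few to kill `G`, so it maps `x` to a constant, possibly
    -- nonzero.
    have hdiff : shiftAct (X - C 1) (shiftAct (S.map (Int.castRingHom ℝ)) (expPolySeq α F G)) = 0 := by
      rw [shiftAct_expPolySeq, hFkill S (Dvd.intro_left _ rfl), zero_add, ← shiftAct_mul]
      have := hGkill ((X - 1) * S) (by
        rw [hS, ← mul_assoc, ← pow_succ']
        exact Dvd.intro _ rfl)
      simpa using this
    obtain ⟨u, hu, p, N, hp, hper⟩ := exists_nearby_eventually_periodic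
      (c₀ := shiftAct (S.map (Int.castRingHom ℝ)) (expPolySeq α F G) 0)
      (fun k => by simpa using apply_eq_pow_mul_of_shiftAct_eq_zero hdiff k) hM hI
    refine hbounded u (X ^ N * ((X ^ p - 1) * S)) ?_ ?_ hu
    · refine mul_ne_zero (pow_ne_zero _ X_ne_zero) (mul_ne_zero ?_ hS0)
      exact (monic_X_pow_sub_C (1 : ℤ) (by omega)).ne_zero
    · refine shiftAct_eq_zero_of_forall_eq_zero fun k hk => ?_
      have h1 : shiftAct ((X ^ p - 1) * S) u k = shiftAct S u (k + p) - shiftAct S u k := by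
        rw [shiftAct_mul, ← shiftAct_X_pow p (shiftAct S u)]
        simp [shiftAct]
      rw [h1, hper k hk, sub_self]
  · rintro ⟨a, b, hab, hlt, hsub⟩
    obtain ⟨c, hc1, hc2⟩ := exists_between hlt
    have hc0 : 0 < c := (sub_nonneg.2 hab).trans_lt hc1
    rw [lt_one_div hc0 (one_div_pos.1 (hc0.trans hc2))] at hc2
    have hne : {t : ℝ | ∃ Q : ℤ[X], Q.eval 1 ≠ 0 ∧
        t = intPolyLength (P ^ (F.natDegree + 1) * Q)}.Nonempty := ⟨_, 1, by simp, rfl⟩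
    obtain ⟨_, ⟨Q, hQ, rfl⟩, hQc⟩ := exists_lt_of_csInf_lt hne hc2
    refine not_limitValues_subset_of_shiftAct_eq hG (R := P ^ (F.natDegree + 1) * Q) ?_ ?_ hc1
      ((lt_div_iff₀ hc0).1 hQc) hsub
    · rw [eval_mul, eval_pow]
      exact mul_ne_zero (pow_ne_zero _ (hP.eval_one_ne_zero hα1)) hQ
    · rw [shiftAct_expPolySeq, hFkill _ (Dvd.intro _ rfl), zero_add]
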